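/- **Setting.** Let $T_{\max}>0$ and let $u:[0,T_{\max}]\to\mathbb C$ solve $$u(t)=a(t)+\int_0^t f(t-\tau)\,g(\tau,u(\tau))\,d\tau ,\qquad 0\le t\le T_{\max},$$ where $f$ is integrable on $(0,T_{\max})$, $g(\cdot,v)$ is continuous for every $v$, and $\tau\mapsto g(\tau,u(\tau))$ is in $C^\gamma([0,T_{\max}])$ with an integer $\gamma\ge\max(p,L)$. Let $\eta>0$ with $|u|\le\eta$, and assume the local Lipschitz condition $|g(\tau,v_1)-g(\tau,v_2)|\le C(\eta)|v_1-v_2|$ for $|v_1|,|v_2|\le\eta$, $0<\tau<T_{\max}$. (Real data are a special case.) *Runge–Kutta method.* Let $(A,b,c)$ be an $S$-stage Runge–Kutta method of order $p$ and stage order $q\le p-1$ with $0\le c_i\le1$, all eigenvalues of $A$ having positive real part, whose stability function $r(z)=1+z\,b^T(I-zA)^{-1}\mathbf 1$ satisfies $|r(z)|\le1$ for $\operatorname{Re}z\le0$ and $r(\infty)=0$. Put $\psi(z)=b^T(I-zA)^{-1}$, and let $h>0$ be the step size, $t_0=n_0h$ with an integer $n_0\ge0$ the splitting parameter, $t=Nh$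 with $N\ge n_0$, $T=t-t_0=N_Th$. *Interpolation.* Given values $G_k$ at the integer steps $kh$, the stage vector $\mathbf g_j$ has the components $G_j$ if $c_i=0$, $G_{j+1}$ if $c_i=1$, and, if $0<c_i<1$, the value obtained by $m$-point interpolation $\sum_{k=1}^m\alpha^i_kG_{j-k+2}$ (on the first steps, where indices would be negative, from the points with indices $0,\dots,m-1$, with corresponding weights). The interpolation is of order $L\ge1$: it reproduces polynomials of degree less than $L$. *Sum of exponentials.* Let $f_{\rm es}(x)=\sum_{\ell=1}^Pm_\ell e^{-s_\ell x}$ with $m_\ell,s_\ell\in\mathbb C$, $\operatorname{Re}s_\ell\ge0$, $\max_\ell|s_\ell h|\le1$, and put $M_\ell=m_\ell e^{-s_\ell t_0}$, $z_\ell=-s_\ell h$. For values $u_0,u_1,\dots$ let $Y_\ell^0=0$, $Y_\ell^{n+1}=r(z_\ell)Y_\ell^n+h\,\psi(z_\ell)\,\mathbf g_n$ with $G_k=g(kh,u_k)$. The Runge–Kutta error is $$E^\ell_{\rm RK}(t)=M_\ell\Big[\int_0^Te^{-s_\ell(T-\tau)}g(\tau,u(\tau))\,d\tau-Y_\ell^{N_T}\Big].$$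 **Part 1.** For all $\sigma,\mu$ there is a constant $C_2(\eta)$, depending only on the equation and its solution, $T_{\max}$, $\eta$, $C(\eta)$, the Runge–Kutta and interpolation coefficients, $\sigma$ and $\mu$ (but not on $h$, $N_T$, $n_0$, the $u_j$, or otherwise on the sum of exponentials), such that whenever $|s_\ell|\le\sigma$ for all $\ell$, $\sum_\ell|M_\ell|\le\mu$, $m-1\le N_T$, $T\le T_{\max}$ and $|u_j|\le\eta$ for $0\le j\le N_T$, one has for every $\ell$ $$|E^\ell_{\rm RK}(t)|\le C_2(\eta)\Big[\max_{0\le j\le N_T}|u_j-u(jh)|+h^p+h^L\Big].$$ **Part 2.** Let $f_M(\tau)=a_0\tau^{-\alpha}+a_1\tau+\dots+a_M\tau^M$, $0\le\alpha<1$, with $f(\tau)-f_M(\tau)=O(\tau^{M+1})$ as $\tau\to0^+$. Let $u_0,\dots,u_{N_{\max}}$, $N_{\max}h\le T_{\max}$, $N_{\max}\ge\max(m,L)-1$, be a numerical solution with $|u_j|\le\eta$, that is, $$u_N=a(Nh)+\int_0^{Nh}f_M(\tau)\,G_N(Nh-\tau)\,d\tau\quad(N\le n_0),$$ $$u_N=a(Nh)+\sum_{\ell=1}^PM_\ell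 Y_\ell^{N-n_0}+\int_0^{t_0}f_M(\tau)\,G_N(Nh-\tau)\,d\tau\quad(N>n_0),$$ where $G_N$ is a piecewise $L$-point Lagrange interpolant of the grid values $g(kh,u_k)$: on each cell $[jh,(j+1)h]$, $j<N$, it is the polynomial through $L$ consecutive grid points which include the end points of the cell (only the left one if $L=1$) and have indices at most $\max(N,L-1)$. Let $0<\varepsilon$, $|f-f_{\rm es}|\le\varepsilon$ on $[t_0,T_{\max}]$, $|s_\ell|\le\sigma$, $\sum_\ell|M_\ell|\le\mu$, and $t_0^{M+1}\le B(h^{M+1}+\varepsilon)$ (for instance $t_0=O(h)$, or $t_0^{M+1}\sim\varepsilon$). Then, with $d=\min\{M+1,L,p\}$, $$|u(Nh)-u_N|\le C\,(h^d+\varepsilon),\qquad 0\le N\le N_{\max},$$ where $C$ depends only on the equation and its solution, $T_{\max}$, $\eta$, $C(\eta)$, $M$, $f_M$, the Runge–Kutta and interpolation coefficients, $\sigma$, $\mu$ and $B$. -/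

import Mathlib

open Set Filter Topology MeasureTheory

noncomputable section

namespace SOEVolterra

/-! Runge-Kutta methods -/

/-- The Butcher tableau of an `S`-stage Runge-Kutta method. -/
structure ButcherTableau (S : ℕ) where
  A : Matrix (Fin S) (Fin S) ℝ
  b : Fin S → ℝ
  c : Fin S → ℝ

namespace ButcherTableau

variable {S : ℕ}

/-- `K` are stage derivatives of one step of size `h` from `(t₀, y₀)` for `y' = F t y`. -/
def IsStages (R : ButcherTableau S) {d : ℕ}
    (F : ℝ → EuclideanSpace ℝ (Fin d) → EuclideanSpace ℝ (Fin d)) (t₀ : ℝ)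
    (y₀ : EuclideanSpace ℝ (Fin d)) (h : ℝ) (K : Fin S → EuclideanSpace ℝ (Fin d)) : Prop :=
  ∀ i, K i = F (t₀ + R.c i * h) (y₀ + h • ∑ j, R.A i j • K j)

/-- The method has order (at least) `p`: for every smooth initial value problem the local
truncation error is `O(h^(p+1))`. As the method is implicit, the stages are those solutions of the
stage equations that stay bounded as `h → 0` (for small `h` there is exactly one such solution). -/
def HasOrder (R : ButcherTableau S) (p : ℕ) : Prop :=
  ∀ (d : ℕ) (F : ℝ → EuclideanSpace ℝ (Fin d) → EuclideanSpace ℝ (Fin d))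
    (y : ℝ → EuclideanSpace ℝ (Fin d)) (t₀ : ℝ),
    ContDiff ℝ (⊤ : ℕ∞) (Function.uncurry F) →
    (∀ᶠ t in 𝓝 t₀, HasDerivAt y (F t (y t)) t) →
    ∀ B : ℝ, ∃ C h₀ : ℝ, 0 < h₀ ∧ ∀ h : ℝ, 0 < h → h < h₀ →
      ∀ K : Fin S → EuclideanSpace ℝ (Fin d),
        R.IsStages F t₀ (y t₀) h K → (∀ i, ‖K i‖ ≤ B) →
        ‖y (t₀ + h) - (y t₀ + h • ∑ i, R.b i • K i)‖ ≤ C * h ^ (p + 1)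

/-- The method has stage order (at least) `q`: for every smooth initial value problem each internal
stage has local error `O(h^(q+1))`. -/
def HasStageOrder (R : ButcherTableau S) (q : ℕ) : Prop :=
  ∀ (d : ℕ) (F : ℝ → EuclideanSpace ℝ (Fin d) → EuclideanSpace ℝ (Fin d))
    (y : ℝ → EuclideanSpace ℝ (Fin d)) (t₀ : ℝ),
    ContDiff ℝ (⊤ : ℕ∞) (Function.uncurry F) →
    (∀ᶠ t in 𝓝 t₀, HasDerivAt y (F t (y t)) t) →
    ∀ B : ℝ, ∃ C h₀ : ℝ, 0 < h₀ ∧ ∀ h : ℝ, 0 < h → h < h₀ →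
      ∀ K : Fin S → EuclideanSpace ℝ (Fin d),
        R.IsStages F t₀ (y t₀) h K → (∀ i, ‖K i‖ ≤ B) →
        ∀ i, ‖y (t₀ + R.c i * h) - (y t₀ + h • ∑ j, R.A i j • K j)‖ ≤ C * h ^ (q + 1)

/-- The coefficient matrix with complex entries. -/
def Ac (R : ButcherTableau S) : Matrix (Fin S) (Fin S) ℂ := R.A.map (fun x => (x : ℂ))

/-- The row vector `ψ(z) = βᵀ (I - z A)⁻¹`. -/
def psi (R : ButcherTableau S) (z : ℂ) : Fin S → ℂ :=
  Matrix.vecMul (fun i => (R.b i : ℂ)) (1 - z • R.Ac)⁻¹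

/-- The stability function `r(z) = 1 + z βᵀ (I - z A)⁻¹ E`, with `E` the vector of ones. -/
def stab (R : ButcherTableau S) (z : ℂ) : ℂ := 1 + z * dotProduct (R.psi z) 1

/-- `|r(z)| ≤ 1` for `Re z ≤ 0`, and `r(∞) = 0`. -/
def IsLStable (R : ButcherTableau S) : Prop :=
  (∀ z : ℂ, z.re ≤ 0 → ‖R.stab z‖ ≤ 1) ∧ Tendsto R.stab (Bornology.cobounded ℂ) (𝓝 0)

/-- All eigenvalues of the coefficient matrix have positive real part. -/
def HasPositiveSpectrum (R : ButcherTableau S) : Prop :=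
  ∀ μ : ℂ, μ ∈ spectrum ℂ R.Ac → 0 < μ.re

end ButcherTableau

/-! Interpolation of internal stages at integer steps -/

/-- Index of the last of the `m` consecutive grid points used on the step from `t_j` to `t_{j+1}`.
It is `j + 1`, so that the points are `t_{j+1}, t_j, …, t_{j-m+2}`; on the first steps, where these
would have negative indices, the first `m` grid points `t_{m-1}, …, t_0` are used. -/
def topNode (m j : ℕ) : ℕ := max (j + 1) (m - 1)

/-- `w δ i k` is the weight, for stage `i`, of the `k`-th point (from the right) of a stencil whose
last point is `t_{j+1+δ}` (`δ = 0` except on the first steps). Order `L`: polynomials of degree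
less than `L` are reproduced at every internal stage. -/
def IsInterpolationOfOrder {S m : ℕ} (R : ButcherTableau S) (w : ℕ → Fin S → Fin m → ℝ)
    (L : ℕ) : Prop :=
  ∀ δ ≤ m - 2, ∀ i, 0 < R.c i → R.c i < 1 → ∀ e < L,
    ∑ k : Fin m, w δ i k * (1 + (δ : ℝ) - (k : ℕ)) ^ e = R.c i ^ e

/-- The stage vector `𝐠_j`, from the values `G k` at the integer steps `t_k`: integer stages
(`c_i = 0` or `c_i = 1`) use the grid value, internal stages are interpolated. -/
def stageVec {S m : ℕ} (R : ButcherTableau S) (w : ℕ → Fin S → Fin m → ℝ) (G : ℕ → ℂ) (j : ℕ) :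
    Fin S → ℂ := fun i =>
  if R.c i = 0 then G j
  else if R.c i = 1 then G (j + 1)
  else ∑ k : Fin m, (w (topNode m j - (j + 1)) i k : ℂ) * G (topNode m j - k)

/-! Sums of exponentials -/

/-- A sum of exponentials `∑ m_ℓ exp(-s_ℓ x)`, with `Re s_ℓ ≥ 0`. -/
structure SOE where
  P : ℕ
  m : Fin P → ℂ
  s : Fin P → ℂ
  re_nonneg : ∀ l, 0 ≤ (s l).re

/-- The value of the sum of exponentials. -/
def SOE.eval (E : SOE) (x : ℝ) : ℂ := ∑ l, E.m l * Complex.exp (-E.s l * x)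

/-- `M_ℓ = m_ℓ exp(-s_ℓ t₀)`. -/
def SOE.M (E : SOE) (t₀ : ℝ) (l : Fin E.P) : ℂ := E.m l * Complex.exp (-E.s l * t₀)

/-- `Y_ℓ(T) = ∫₀ᵀ exp(-s (T - τ)) φ(τ) dτ`, the solution at `T` of `Y' = -s Y + φ`, `Y(0) = 0`. -/
def exactY (s : ℂ) (φ : ℝ → ℂ) (T : ℝ) : ℂ :=
  ∫ τ in (0 : ℝ)..T, Complex.exp (-s * (T - τ)) * φ τ

/-- The Runge-Kutta solution `Y^n` of `Y' = -s Y + φ`, `Y(0) = 0`, with step `h`, with the stage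
values of `φ` obtained from approximate values `G k` of `φ(t_k)`:
`Y^{n+1} = r(z) Y^n + h ψ(z) 𝐠_n`, where `z = -s h`. -/
def rkY {S m : ℕ} (R : ButcherTableau S) (w : ℕ → Fin S → Fin m → ℝ) (s : ℂ) (h : ℝ)
    (G : ℕ → ℂ) : ℕ → ℂ
  | 0 => 0
  | n + 1 => R.stab (-s * h) * rkY R w s h G n
      + h * dotProduct (R.psi (-s * h)) (stageVec R w G n)

/-- The Runge-Kutta error `E_RK^ℓ(t)` at `t = t₀ + n h`: the contribution
`M_ℓ (Y_ℓ(T) - Y_ℓ^n)`, `T = n h`, of the `ℓ`-th exponential to the error of the solution, where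
`Y_ℓ` is driven by `g(τ, u(τ))` and `Y_ℓ^n` by the values `g(t_k, U_k)` at the integer steps. -/
def rkError {S m : ℕ} (R : ButcherTableau S) (w : ℕ → Fin S → Fin m → ℝ) (E : SOE)
    (g : ℝ → ℂ → ℂ) (u : ℝ → ℂ) (U : ℕ → ℂ) (t₀ h : ℝ) (n : ℕ) (l : Fin E.P) : ℂ :=
  E.M t₀ l * (exactY (E.s l) (fun τ => g τ (u τ)) (n * h)
    - rkY R w (E.s l) h (fun k => g (k * h) (U k)) n)

/-! The local part and the full scheme -/

/-- The generalized Taylor polynomial `f_M(τ) = a₀ τ^(-α) + a₁ τ + ⋯ + a_M τ^M`. -/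
def genTaylor (α : ℝ) (κ : ℕ → ℂ) (M : ℕ) (τ : ℝ) : ℂ :=
  κ 0 * ((τ ^ (-α) : ℝ) : ℂ) + ∑ k ∈ Finset.Icc 1 M, κ k * (τ : ℂ) ^ k

/-- The `L`-point piecewise polynomial interpolant of grid values `G k ≈ G(k h)`: for `x` in the
cell `[t_j, t_{j+1})` it is the Lagrange polynomial on `t_{ν j}, …, t_{ν j + L - 1}` (in the
variable `x / h`). -/
def localInterp (L : ℕ) (ν : ℕ → ℕ) (h : ℝ) (G : ℕ → ℂ) (x : ℝ) : ℂ :=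
  (Lagrange.interpolate (Finset.range L) (fun k => ((ν ⌊x / h⌋₊ + k : ℕ) : ℂ))
    (fun k => G (ν ⌊x / h⌋₊ + k))).eval ((x / h : ℝ) : ℂ)

/-- Admissible stencils at time step `N`: the stencil of each cell `[t_j, t_{j+1}]` contains the
end points of the cell (only the left one if `L = 1`), and uses grid points up to `t_N` only, except
that on the first steps the grid points `t_0, …, t_{L-1}` are used. -/
def IsAdmissible (L : ℕ) (ν : ℕ → ℕ → ℕ) : Prop :=
  ∀ N j, j < N → ν N j ≤ j ∧ j + 1 < ν N j + max L 2 ∧ ν N j + L ≤ max (N + 1) L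

/-- `U 0, …, U Nmax` is a numerical solution, with step `h` and `t₀ = n₀ h`, of
`u(t) = a(t) + ∫₀ᵗ f(t - τ) g(τ, u(τ)) dτ`. Up to time `t₀` the kernel is replaced by `fM` and
`g(τ, u(τ))` by its local interpolant; later this is done for the part of the integral where the
argument of the kernel is in `[0, t₀]`, and the rest is treated with the sum of exponentials and the
Runge-Kutta method. -/
structure IsNumericalSolution {S m : ℕ} (R : ButcherTableau S) (w : ℕ → Fin S → Fin m → ℝ)
    (E : SOE) (a : ℝ → ℂ) (g : ℝ → ℂ → ℂ) (fM : ℝ → ℂ) (L : ℕ) (ν : ℕ → ℕ → ℕ) (h : ℝ)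
    (n₀ Nmax : ℕ) (U : ℕ → ℂ) : Prop where
  start : ∀ N ≤ Nmax, N ≤ n₀ →
    U N = a (N * h) + ∫ τ in (0 : ℝ)..(N * h),
      fM τ * localInterp L (ν N) h (fun k => g (k * h) (U k)) (N * h - τ)
  step : ∀ N ≤ Nmax, n₀ < N →
    U N = a (N * h)
      + ∑ l, E.M (n₀ * h) l * rkY R w (E.s l) h (fun k => g (k * h) (U k)) (N - n₀)
      + ∫ τ in (0 : ℝ)..(n₀ * h),
          fM τ * localInterp L (ν N) h (fun k => g (k * h) (U k)) (N * h - τ)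

/-- The parameters of the sum of exponentials are bounded: `|s_ℓ| ≤ σ` and `∑ |M_ℓ| ≤ μ`. -/
def SOE.IsBoundedBy (E : SOE) (t₀ σ μ : ℝ) : Prop :=
  (∀ l, ‖E.s l‖ ≤ σ) ∧ ∑ l, ‖E.M t₀ l‖ ≤ μ

end SOEVolterra

end

open SOEVolterra

/-! Part 1. For `Y' = -sY + φ` the local error of one Runge–Kutta step splits, after a Taylor
expansion of `φ` of degree below `p`, into quadrature defects on the monomials `x^k / k!` plus an
`O(h^(p+1))` remainder. Exact moments and numerical quadrature obey parallel recursions: integration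
by parts (`expMoment_succ`) and the resolvent identity (`psi_dotProduct`) each split off a term and
leave a factor `-s`. The split-off terms agree by the order conditions `b·A^j c^k = k!/(k+j+1)!`,
which come from applying `HasOrder` to a chain of integrators. Iterating up to degree `p` makes each
defect `O(h^(p+1))`, uniformly for `|s| ≤ σ`. Since `|r(z)| ≤ 1`, local errors, interpolation errors
and perturbations of the data only add up (`exists_rkY_bound`).

Part 2. The convolution at `Nh` is split at `min(N, n₀)h`. On the local part, replacing `f` by `f_M`
costs `O(t₀^(M+1))` and interpolation costs `O(h^L)`; on the tail, the sum of exponentials costs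
`O(ε)` and the Runge–Kutta method `O(h^p + h^L)`. All further terms are Lipschitz in the grid errors
`e_k`.

These terms are absorbed in the norm `max_k e_k exp(-r k h)`. For large `r` the weight makes both
the convolution with the integrable kernel `|f_M|` and the Runge–Kutta sum small
(`tendsto_integral_mul_exp_neg`, `mul_sum_exp_le`), so the error map is a contraction by 1/2. The
norm sees all indices at once, hence implicit steps and starting stencils that reach beyond `N` need
no separate treatment. -/

noncomputable section

namespace SOEVolterra

/-! ### Order conditions for linear problems, and the resolvent on the left half plane. -/

namespace ButcherTableau

variable {S : ℕ}

/-- The scaled powers `c^k / k!` of the abscissae. -/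
def absc (R : ButcherTableau S) (k : ℕ) : Fin S → ℝ := fun i => R.c i ^ k / (k.factorial : ℝ)

/-- The right-hand side of `y₀' = t^k / k!`, `y_{i+1}' = y_i`. -/
def chainField (k j : ℕ) (t : ℝ) (y : EuclideanSpace ℝ (Fin (j + 1))) :
    EuclideanSpace ℝ (Fin (j + 1)) :=
  WithLp.toLp 2 (Fin.cases (t ^ k / (k.factorial : ℝ)) (fun i : Fin j => y i.castSucc))

/-- The solution of `y₀' = t^k / k!`, `y_{i+1}' = y_i`, `y(0) = 0`. -/
def chainSol (k j : ℕ) (t : ℝ) : EuclideanSpace ℝ (Fin (j + 1)) :=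
  WithLp.toLp 2 (fun i => t ^ (k + i + 1) / ((k + i + 1).factorial : ℝ))

theorem contDiff_chainField (k j : ℕ) :
    ContDiff ℝ (⊤ : ℕ∞) (Function.uncurry (chainField k j)) := by
  rw [contDiff_euclidean]
  intro i
  refine Fin.cases ?_ (fun i => ?_) i
  · simp only [Function.uncurry, chainField, Fin.cases_zero]
    fun_prop
  · simp only [Function.uncurry, chainField, Fin.cases_succ]
    fun_prop

theorem hasDerivAt_pow_div_factorial (n : ℕ) (t : ℝ) :
    HasDerivAt (fun t : ℝ => t ^ (n + 1) / ((n + 1).factorial : ℝ)) (t ^ n / (n.factorial : ℝ)) t := by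
  refine ((hasDerivAt_pow (n + 1) t).div_const ((n + 1).factorial : ℝ)).congr_deriv ?_
  have : (n.factorial : ℝ) ≠ 0 := by positivity
  rw [Nat.factorial_succ]
  push_cast
  field_simp

theorem hasDerivAt_chainSol (k j : ℕ) (t : ℝ) :
    HasDerivAt (chainSol k j) (chainField k j t (chainSol k j t)) t := by
  rw [hasDerivAt_iff_hasFDerivAt, ← hasFDerivWithinAt_univ, hasFDerivWithinAt_euclidean]
  intro i
  rw [hasFDerivWithinAt_univ]
  suffices h : HasDerivAt (fun x => chainSol k j x i) (chainField k j t (chainSol k j t) i) t by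
    exact h.hasFDerivAt.congr_fderiv (by ext; simp)
  refine Fin.cases ?_ (fun i => ?_) i
  · exact hasDerivAt_pow_div_factorial k t
  · have h := hasDerivAt_pow_div_factorial (k + i + 1) t
    simpa [chainSol, chainField, add_assoc] using h

/-- The order conditions for linear problems. -/
theorem HasOrder.order_condition {R : ButcherTableau S} {p : ℕ} (hp : R.HasOrder p) {j k : ℕ}
    (hjk : j + k + 1 ≤ p) :
    dotProduct R.b ((R.A ^ j).mulVec (R.absc k)) = 1 / ((k + j + 1).factorial : ℝ) := by
  -- The stage equations of the chain are triangular, so their solution is explicit. It is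
  -- polynomial in `h`, hence bounded on `[0, 1]`, as the bounded-stage clause of `HasOrder`
  -- requires.
  let K : ℝ → Fin S → EuclideanSpace ℝ (Fin (j + 1)) := fun h i =>
    WithLp.toLp 2 (fun l => h ^ (k + l) * (R.A ^ (l : ℕ)).mulVec (R.absc k) i)
  have hKc : ∀ i, Continuous fun h => K h i := by
    intro i
    refine (PiLp.continuous_toLp 2 _).comp ?_
    fun_prop
  have hB : ∀ i, ∃ B, ∀ h ∈ Icc (0 : ℝ) 1, ‖K h i‖ ≤ B := fun i =>
    isCompact_Icc.exists_bound_of_continuousOn (hKc i).continuousOn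
  choose B hB using hB
  have hstage : ∀ h, R.IsStages (chainField k j) 0 (chainSol k j 0) h (K h) := by
    intro h i
    ext l
    refine Fin.cases ?_ (fun l => ?_) l
    · simp [chainField, K, absc, mul_pow]
      ring
    · simp only [chainField, K, Fin.cases_succ, chainSol, PiLp.add_apply, PiLp.smul_apply,
        smul_eq_mul, WithLp.ofLp_sum, Finset.sum_apply, WithLp.ofLp_smul, Pi.smul_apply,
        Fin.val_succ, Fin.val_castSucc]
      rw [pow_succ' R.A, ← Matrix.mulVec_mulVec]
      simp only [Matrix.mulVec, dotProduct, Finset.mul_sum]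
      simp only [ne_eq, Nat.add_eq_zero_iff, one_ne_zero, and_false, not_false_eq_true, zero_pow,
        zero_div, zero_add]
      refine Finset.sum_congr rfl fun x _ => Finset.sum_congr rfl fun y _ => ?_
      ring
  obtain ⟨C, h₀, hh₀, H⟩ := hp (j + 1) (chainField k j) (chainSol k j) 0
    (contDiff_chainField k j) (Eventually.of_forall (hasDerivAt_chainSol k j)) (∑ i, |B i|)
  have key : ∀ h, 0 < h → h < min h₀ 1 →
      |1 / ((k + j + 1).factorial : ℝ) - dotProduct R.b ((R.A ^ j).mulVec (R.absc k))| ≤ |C| * h := by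
    intro h h0 h1
    have h2 := H h h0 (h1.trans_le (min_le_left _ _)) (K h) (hstage h) (fun i =>
      ((hB i h ⟨h0.le, (h1.trans_le (min_le_right _ _)).le⟩).trans (le_abs_self _)).trans
        (Finset.single_le_sum (f := fun i => |B i|) (fun _ _ => abs_nonneg _) (Finset.mem_univ i)))
    have h3 := (PiLp.norm_apply_le _ (Fin.last j)).trans h2
    -- The last coordinate of the step error is exactly `h^(k+j+1)` times the defect in the order
    -- condition. As `k + j + 1 ≤ p`, dividing by this power still leaves a factor `h`, and `h → 0`
    -- finishes.
    have h4 : (chainSol k j (0 + h) - (chainSol k j 0 + h • ∑ i, R.b i • K h i)) (Fin.last j)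
        = h ^ (k + j + 1) * (1 / ((k + j + 1).factorial : ℝ)
          - dotProduct R.b ((R.A ^ j).mulVec (R.absc k))) := by
      simp only [chainSol, K, PiLp.sub_apply, PiLp.add_apply, PiLp.smul_apply, smul_eq_mul,
        WithLp.ofLp_sum, Finset.sum_apply, WithLp.ofLp_smul, Pi.smul_apply, Fin.val_last, zero_add]
      simp only [dotProduct, mul_sub, Finset.mul_sum]
      simp only [ne_eq, Nat.add_eq_zero_iff, one_ne_zero, and_false, not_false_eq_true, zero_pow,
        zero_div, zero_add]
      congr 1
      · ring
      · refine Finset.sum_congr rfl fun x _ => ?_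
        ring
    rw [h4, Real.norm_eq_abs, abs_mul, abs_of_pos (pow_pos h0 _)] at h3
    have h5 : C * h ^ (p + 1) ≤ h ^ (k + j + 1) * (|C| * h) := by
      have : h ^ (p + 1) ≤ h ^ (k + j + 1 + 1) :=
        pow_le_pow_of_le_one h0.le (h1.trans_le (min_le_right _ _)).le (by omega)
      calc C * h ^ (p + 1) ≤ |C| * h ^ (p + 1) := by gcongr; exact le_abs_self C
        _ ≤ |C| * h ^ (k + j + 1 + 1) := by gcongr
        _ = _ := by ring
    exact le_of_mul_le_mul_left (h3.trans h5) (pow_pos h0 _)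
  have h6 : |1 / ((k + j + 1).factorial : ℝ) - dotProduct R.b ((R.A ^ j).mulVec (R.absc k))| ≤ 0 := by
    have ht : Tendsto (fun h : ℝ => |C| * h) (𝓝[>] 0) (𝓝 0) := by
      have : Tendsto (fun h : ℝ => |C| * h) (𝓝 0) (𝓝 (|C| * 0)) := by
        exact (continuous_const.mul continuous_id).tendsto 0
      rw [mul_zero] at this
      exact this.mono_left nhdsWithin_le_nhds
    refine ge_of_tendsto ht ?_
    filter_upwards [Ioo_mem_nhdsGT (lt_min hh₀ one_pos)] with h hh using key h hh.1 hh.2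
  have h7 := abs_nonpos_iff.1 h6
  linarith

/-- `I - z A` is invertible on the closed left half plane. -/
theorem HasPositiveSpectrum.isUnit {R : ButcherTableau S} (hR : R.HasPositiveSpectrum) {z : ℂ}
    (hz : z.re ≤ 0) : IsUnit (1 - z • R.Ac) := by
  by_cases h0 : z = 0
  · simp [h0]
  by_contra hn
  -- A singular `I - zA` would make `1/z` an eigenvalue, yet its real part has the sign of `Re z`.
  have hmem : z⁻¹ ∈ spectrum ℂ R.Ac := by
    rw [spectrum.mem_iff]
    intro hu
    apply hn
    have : (1 - z • R.Ac) = (Units.mk0 z h0) • (algebraMap ℂ (Matrix (Fin S) (Fin S) ℂ) z⁻¹ - R.Ac) := by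
      rw [Units.smul_def, smul_sub, Units.val_mk0, ← algebraMap_smul (Matrix (Fin S) (Fin S) ℂ) z
        (algebraMap ℂ (Matrix (Fin S) (Fin S) ℂ) z⁻¹), smul_eq_mul, ← map_mul, mul_inv_cancel₀ h0,
        map_one]
    rw [this]
    exact hu.smul _
  have h1 := hR _ hmem
  rw [Complex.inv_re] at h1
  exact absurd h1 (not_lt.2 (div_nonpos_of_nonpos_of_nonneg hz (Complex.normSq_nonneg z)))

/-- `ψ` is bounded on the left half of the unit disc. -/
theorem HasPositiveSpectrum.exists_psi_bound {R : ButcherTableau S} (hR : R.HasPositiveSpectrum) :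
    ∃ Ψ : ℝ, 0 ≤ Ψ ∧ ∀ z : ℂ, z.re ≤ 0 → ‖z‖ ≤ 1 → ∑ i, ‖R.psi z i‖ ≤ Ψ := by
  have hcomp : IsCompact (Metric.closedBall (0 : ℂ) 1 ∩ {z : ℂ | z.re ≤ 0}) :=
    (isCompact_closedBall 0 1).inter_right (isClosed_le Complex.continuous_re continuous_const)
  have hcont : ContinuousOn (fun z => ∑ i, ‖R.psi z i‖)
      (Metric.closedBall (0 : ℂ) 1 ∩ {z : ℂ | z.re ≤ 0}) := by
    have hM : Continuous fun z : ℂ => (1 - z • R.Ac) := by fun_prop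
    refine continuousOn_finsetSum _ fun i _ => ContinuousOn.norm ?_
    simp only [psi, Matrix.vecMul, dotProduct]
    refine continuousOn_finsetSum _ fun j _ => continuousOn_const.mul ?_
    -- Cramer's formula reduces continuity of the inverse to a nonvanishing determinant.
    have : (fun z : ℂ => (1 - z • R.Ac)⁻¹ j i)
        = fun z : ℂ => ((1 - z • R.Ac).det)⁻¹ * (1 - z • R.Ac).adjugate j i := by
      funext z
      rw [Matrix.inv_def, Ring.inverse_eq_inv', Matrix.smul_apply, smul_eq_mul]
    rw [this]
    refine ContinuousOn.mul (ContinuousOn.inv₀ hM.matrix_det.continuousOn ?_)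
      (hM.matrix_adjugate.matrix_elem j i).continuousOn
    intro z hz
    exact ((Matrix.isUnit_iff_isUnit_det _).1 (hR.isUnit hz.2)).ne_zero
  obtain ⟨Ψ, hΨ⟩ := hcomp.exists_bound_of_continuousOn hcont
  refine ⟨|Ψ|, abs_nonneg _, fun z h1 h2 => ?_⟩
  exact ((le_abs_self _).trans (hΨ z ⟨by simpa using h2, h1⟩)).trans (le_abs_self _)

/-- This is `ψ(I - zA) = b` tested on `v`. It is the discrete counterpart of integration by parts:
each use trades a factor `z` for a factor `A`. -/
theorem HasPositiveSpectrum.psi_dotProduct {R : ButcherTableau S} (hR : R.HasPositiveSpectrum)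
    {z : ℂ} (hz : z.re ≤ 0) (v : Fin S → ℂ) :
    dotProduct (R.psi z) v = dotProduct (fun i => (R.b i : ℂ)) v
      + z * dotProduct (R.psi z) (R.Ac.mulVec v) := by
  have hu := (Matrix.isUnit_iff_isUnit_det _).1 (hR.isUnit hz)
  have h1 : Matrix.vecMul (R.psi z) (1 - z • R.Ac) = fun i => (R.b i : ℂ) := by
    rw [psi, Matrix.vecMul_vecMul, Matrix.nonsing_inv_mul _ hu, Matrix.vecMul_one]
  rw [← h1, ← Matrix.dotProduct_mulVec, Matrix.sub_mulVec, Matrix.one_mulVec, Matrix.smul_mulVec,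
    dotProduct_sub, dotProduct_smul, smul_eq_mul]
  ring

theorem norm_psi_dotProduct_le (R : ButcherTableau S) {z : ℂ} {Ψ β : ℝ}
    (hΨ : ∑ i, ‖R.psi z i‖ ≤ Ψ) {v : Fin S → ℂ} (hβ : 0 ≤ β) (hv : ∀ i, ‖v i‖ ≤ β) :
    ‖dotProduct (R.psi z) v‖ ≤ Ψ * β := by
  calc ‖dotProduct (R.psi z) v‖ ≤ ∑ i, ‖R.psi z i * v i‖ := norm_sum_le _ _
    _ ≤ ∑ i, ‖R.psi z i‖ * β := by
        refine Finset.sum_le_sum fun i _ => ?_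
        rw [norm_mul]
        exact mul_le_mul_of_nonneg_left (hv i) (norm_nonneg _)
    _ = (∑ i, ‖R.psi z i‖) * β := by rw [Finset.sum_mul]
    _ ≤ Ψ * β := mul_le_mul_of_nonneg_right hΨ hβ

end ButcherTableau

/-! ### Uniform Taylor expansions and exponential moments. -/

/-- Taylor's theorem at every point of an interval, with uniform constants. -/
theorem exists_taylor_bound {T : ℝ} (hT : 0 < T) (n : ℕ) {φ : ℝ → ℂ}
    (hφ : ContDiffOn ℝ n φ (Icc 0 T)) :
    ∃ C : ℝ, 0 ≤ C ∧ ∀ x₀ ∈ Icc 0 T, ∃ a : ℕ → ℂ, (∀ k, ‖a k‖ ≤ C) ∧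
      ∀ x ∈ Icc 0 T, ‖φ x - ∑ k ∈ Finset.range n,
        a k * (((x - x₀) ^ k / (k.factorial : ℝ) : ℝ) : ℂ)‖ ≤ C * |x - x₀| ^ n := by
  induction n generalizing φ with
  | zero =>
    obtain ⟨C, hC⟩ := isCompact_Icc.exists_bound_of_continuousOn hφ.continuousOn
    refine ⟨|C|, abs_nonneg _, fun x₀ _ => ⟨0, by simp, fun x hx => ?_⟩⟩
    simpa using (hC x hx).trans (le_abs_self C)
  | succ n ih =>
    obtain ⟨C₀, hC₀⟩ := isCompact_Icc.exists_bound_of_continuousOn hφ.continuousOn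
    have hu := uniqueDiffOn_Icc hT
    obtain ⟨C₁, hC₁0, hC₁⟩ := ih (φ := derivWithin φ (Icc 0 T))
      (hφ.derivWithin hu (by norm_cast))
    refine ⟨max |C₀| C₁, (abs_nonneg _).trans (le_max_left _ _), fun x₀ hx₀ => ?_⟩
    obtain ⟨a, ha, hbd⟩ := hC₁ x₀ hx₀
    -- With the normalisation by `k!`, integrating the expansion of the derivative just shifts the
    -- coefficients; the new constant term is the value at the centre.
    refine ⟨fun k => Nat.casesOn k (φ x₀) a, fun k => ?_, fun x hx => ?_⟩
    · cases k with
      | zero => exact (hC₀ x₀ hx₀).trans ((le_abs_self _).trans (le_max_left _ _))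
      | succ k => exact (ha k).trans (le_max_right _ _)
    · have hsub : uIcc x₀ x ⊆ Icc 0 T := by
        intro y hy
        rcases le_total x₀ x with h | h
        · rw [uIcc_of_le h] at hy
          exact ⟨hx₀.1.trans hy.1, hy.2.trans hx.2⟩
        · rw [uIcc_of_ge h] at hy
          exact ⟨hx.1.trans hy.1, hy.2.trans hx₀.2⟩
      let Q : ℝ → ℂ := fun y => ∑ k ∈ Finset.range n,
        a k * (((y - x₀) ^ (k + 1) / ((k + 1).factorial : ℝ) : ℝ) : ℂ)
      have hQ : ∀ y, HasDerivAt Q (∑ k ∈ Finset.range n,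
          a k * (((y - x₀) ^ k / (k.factorial : ℝ) : ℝ) : ℂ)) y := by
        intro y
        refine HasDerivAt.fun_sum fun k _ => ?_
        have h := (ButcherTableau.hasDerivAt_pow_div_factorial k (y - x₀)).comp_sub_const y x₀
        exact h.ofReal_comp.const_mul (a k)
      have hder : ∀ y ∈ uIcc x₀ x, HasDerivWithinAt (fun y => φ y - Q y)
          (derivWithin φ (Icc 0 T) y - ∑ k ∈ Finset.range n,
            a k * (((y - x₀) ^ k / (k.factorial : ℝ) : ℝ) : ℂ)) (uIcc x₀ x) y := by
        intro y hy
        refine HasDerivWithinAt.sub ?_ (hQ y).hasDerivWithinAt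
        exact ((hφ.differentiableOn (by simp) y (hsub hy)).hasDerivWithinAt).mono hsub
      have hle : ∀ y ∈ uIcc x₀ x, ‖derivWithin φ (Icc 0 T) y - ∑ k ∈ Finset.range n,
            a k * (((y - x₀) ^ k / (k.factorial : ℝ) : ℝ) : ℂ)‖ ≤ C₁ * |x - x₀| ^ n := by
        intro y hy
        refine (hbd y (hsub hy)).trans ?_
        exact mul_le_mul_of_nonneg_left
          (pow_le_pow_left₀ (abs_nonneg _) (abs_sub_left_of_mem_uIcc hy) _) hC₁0
      -- The mean value inequality supplies the extra factor `|x - x₀|` on either side of the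
      -- centre.
      have h := (convex_uIcc x₀ x).norm_image_sub_le_of_norm_hasDerivWithin_le hder hle
        left_mem_uIcc right_mem_uIcc
      have hQ0 : Q x₀ = 0 := by simp [Q]
      rw [Finset.sum_range_succ']
      have e : φ x - (∑ k ∈ Finset.range n,
          a k * (((x - x₀) ^ (k + 1) / ((k + 1).factorial : ℝ) : ℝ) : ℂ)
          + φ x₀ * (((x - x₀) ^ 0 / (Nat.factorial 0 : ℝ) : ℝ) : ℂ)) = φ x - Q x - (φ x₀ - Q x₀) := by
        rw [hQ0]; simp [Q]; ring
      refine (le_of_eq (congrArg norm e)).trans (h.trans ?_)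
      rw [Real.norm_eq_abs, pow_succ, mul_assoc]
      gcongr
      exact le_max_right _ _

/-- The moments `∫₀ʰ exp(-s (h - x)) x^k / k! dx`. -/
def expMoment (s : ℂ) (h : ℝ) (k : ℕ) : ℂ :=
  ∫ x in (0 : ℝ)..h, Complex.exp (-s * (h - x)) * ((x ^ k / (k.factorial : ℝ) : ℝ) : ℂ)

theorem norm_exp_neg_mul_le_one {s : ℂ} (hs : 0 ≤ s.re) {x y : ℝ} (hxy : x ≤ y) :
    ‖Complex.exp (-s * (y - x))‖ ≤ 1 := by
  rw [Complex.norm_exp, Real.exp_le_one_iff, ← Complex.ofReal_sub, Complex.re_mul_ofReal,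
    Complex.neg_re]
  nlinarith

/-- Integration by parts against `x^(k+1) / (k+1)!`; the lower boundary term vanishes. -/
theorem expMoment_succ (s : ℂ) (h : ℝ) (k : ℕ) :
    expMoment s h k = ((h ^ (k + 1) / ((k + 1).factorial : ℝ) : ℝ) : ℂ) - s * expMoment s h (k + 1) := by
  have hd : ∀ x ∈ uIcc 0 h, HasDerivAt
      (fun x : ℝ => Complex.exp (-s * (h - x)) * ((x ^ (k + 1) / ((k + 1).factorial : ℝ) : ℝ) : ℂ))
      (s * (Complex.exp (-s * (h - x)) * ((x ^ (k + 1) / ((k + 1).factorial : ℝ) : ℝ) : ℂ))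
        + Complex.exp (-s * (h - x)) * ((x ^ k / (k.factorial : ℝ) : ℝ) : ℂ)) x := by
    intro x _
    have h1 : HasDerivAt (fun x : ℝ => -s * ((h : ℂ) - (x : ℂ))) s x := by
      have := ((Complex.ofRealCLM.hasDerivAt (x := x)).const_sub (h : ℂ)).const_mul (-s)
      simpa using this
    refine (h1.cexp.mul (ButcherTableau.hasDerivAt_pow_div_factorial k x).ofReal_comp).congr_deriv ?_
    ring
  have hc1 : Continuous fun x : ℝ => s * (Complex.exp (-s * (h - x)) *
      ((x ^ (k + 1) / ((k + 1).factorial : ℝ) : ℝ) : ℂ)) := by fun_prop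
  have hc2 : Continuous fun x : ℝ => Complex.exp (-s * (h - x)) *
      ((x ^ k / (k.factorial : ℝ) : ℝ) : ℂ) := by fun_prop
  have h2 := intervalIntegral.integral_eq_sub_of_hasDerivAt hd
    ((hc1.add hc2).intervalIntegrable 0 h)
  rw [intervalIntegral.integral_add (hc1.intervalIntegrable _ _) (hc2.intervalIntegrable _ _),
    intervalIntegral.integral_const_mul] at h2
  simp only [sub_self, mul_zero, Complex.exp_zero, one_mul] at h2
  rw [expMoment, expMoment, eq_sub_iff_add_eq', h2]
  simp

theorem norm_expMoment_le {s : ℂ} (hs : 0 ≤ s.re) {h : ℝ} (hh : 0 ≤ h) (k : ℕ) :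
    ‖expMoment s h k‖ ≤ h ^ (k + 1) := by
  have := intervalIntegral.norm_integral_le_of_norm_le_const (a := 0) (b := h) (C := h ^ k)
    (f := fun x : ℝ => Complex.exp (-s * (h - x)) * ((x ^ k / (k.factorial : ℝ) : ℝ) : ℂ)) (by
      intro x hx
      rw [uIoc_of_le hh] at hx
      rw [norm_mul, Complex.norm_real, Real.norm_eq_abs,
        abs_of_nonneg (div_nonneg (pow_nonneg hx.1.le _) (Nat.cast_nonneg _))]
      calc _ ≤ 1 * (x ^ k / (k.factorial : ℝ)) :=
            mul_le_mul_of_nonneg_right (norm_exp_neg_mul_le_one hs hx.2)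
              (div_nonneg (pow_nonneg hx.1.le _) (Nat.cast_nonneg _))
        _ ≤ x ^ k := by
          rw [one_mul]
          exact div_le_self (pow_nonneg hx.1.le _) (by exact_mod_cast Nat.one_le_iff_ne_zero.2 (Nat.factorial_ne_zero k))
        _ ≤ h ^ k := pow_le_pow_left₀ hx.1.le hx.2 _)
  rw [sub_zero, abs_of_nonneg hh] at this
  rw [pow_succ]
  exact this

/-! ### Quadrature defects on monomials. -/

namespace ButcherTableau

variable {S : ℕ}

/-- The vector `v` with complex entries. -/
def toComplex (v : Fin S → ℝ) : Fin S → ℂ := fun i => (v i : ℂ)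

theorem Ac_mulVec_toComplex (R : ButcherTableau S) (v : Fin S → ℝ) :
    R.Ac.mulVec (toComplex v) = toComplex (R.A.mulVec v) := by
  ext i
  simp [Ac, Matrix.mulVec, dotProduct, toComplex]

theorem dotProduct_toComplex (b v : Fin S → ℝ) :
    dotProduct (fun i => (b i : ℂ)) (toComplex v) = ((dotProduct b v : ℝ) : ℂ) := by
  simp [dotProduct, toComplex]

/-- The quadrature defect of the method for the monomial `x^k / k!`. -/
def defect (R : ButcherTableau S) (s : ℂ) (h : ℝ) (k : ℕ) : ℂ :=
  expMoment s h k - (h : ℂ) ^ (k + 1) * dotProduct (R.psi (-s * h)) (toComplex (R.absc k))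

/-- At each step the boundary term `h^(k+n+1)/(k+n+1)!` of the moment cancels against the term
`b·A^n c^k/k!` of the quadrature, by the order condition. What remains has the same shape, one
degree higher and multiplied by `-s`. -/
theorem HasOrder.defect_eq {R : ButcherTableau S} {p : ℕ} (hp : R.HasOrder p)
    (hR : R.HasPositiveSpectrum) {s : ℂ} (hs : 0 ≤ s.re) {h : ℝ} (hh : 0 ≤ h) (k : ℕ) :
    ∀ n : ℕ, k + n ≤ p → R.defect s h k = (-s) ^ n * (expMoment s h (k + n)
      - (h : ℂ) ^ (k + n + 1) * dotProduct (R.psi (-s * h))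
        (toComplex ((R.A ^ n).mulVec (R.absc k)))) := by
  intro n
  induction n with
  | zero => simp [defect]
  | succ n ih =>
    intro hn
    have hz : (-s * (h : ℂ)).re ≤ 0 := by
      rw [Complex.re_mul_ofReal, Complex.neg_re]; nlinarith
    have ho := hp.order_condition (j := n) (k := k) (by omega)
    rw [ih (by omega), expMoment_succ, hR.psi_dotProduct hz, dotProduct_toComplex, ho,
      Ac_mulVec_toComplex, Matrix.mulVec_mulVec, ← pow_succ']
    push_cast
    rw [← add_assoc k n 1]
    ring

/-- The recursion is run up to degree `p`, where moment and quadrature are each `O(h^(p+1))` without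
any cancellation. The price `|s|^(p-k)` is controlled by `σ`. -/
theorem HasOrder.exists_defect_bound {R : ButcherTableau S} {p : ℕ} (hp : R.HasOrder p)
    (hR : R.HasPositiveSpectrum) (σ : ℝ) :
    ∃ C : ℝ, 0 ≤ C ∧ ∀ (s : ℂ) (h : ℝ), 0 ≤ s.re → ‖s‖ ≤ σ → 0 ≤ h → ‖s * h‖ ≤ 1 →
      ∀ k ≤ p, ‖R.defect s h k‖ ≤ C * h ^ (p + 1) := by
  obtain ⟨Ψ, hΨ0, hΨ⟩ := hR.exists_psi_bound
  let D : ℝ := ∑ k ∈ Finset.range (p + 1), ∑ i, |(R.A ^ (p - k)).mulVec (R.absc k) i|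
  have hD0 : 0 ≤ D := by positivity
  refine ⟨max 1 |σ| ^ p * (1 + Ψ * D), by positivity, fun s h hs hsσ hh hsh k hk => ?_⟩
  have hz : (-s * (h : ℂ)).re ≤ 0 := by
    rw [Complex.re_mul_ofReal, Complex.neg_re]; nlinarith
  rw [hp.defect_eq hR hs hh k (p - k) (by omega), Nat.add_sub_cancel' hk, norm_mul, norm_pow,
    norm_neg, mul_assoc]
  have h1 : ‖s‖ ^ (p - k) ≤ max 1 |σ| ^ p :=
    (pow_le_pow_left₀ (norm_nonneg _) (hsσ.trans ((le_abs_self _).trans (le_max_right _ _))) _).trans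
      (pow_le_pow_right₀ (le_max_left _ _) (Nat.sub_le _ _))
  have h2 : ‖dotProduct (R.psi (-s * h)) (toComplex ((R.A ^ (p - k)).mulVec (R.absc k)))‖ ≤ Ψ * D := by
    refine R.norm_psi_dotProduct_le (hΨ _ hz (by simpa using hsh)) hD0 fun i => ?_
    rw [toComplex, Complex.norm_real, Real.norm_eq_abs]
    refine (Finset.single_le_sum (f := fun i => |(R.A ^ (p - k)).mulVec (R.absc k) i|)
      (fun _ _ => abs_nonneg _) (Finset.mem_univ i)).trans ?_
    exact Finset.single_le_sum (f := fun k => ∑ i, |(R.A ^ (p - k)).mulVec (R.absc k) i|)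
      (fun _ _ => by positivity) (Finset.mem_range.2 (by omega : k < p + 1))
  refine mul_le_mul h1 ?_ (norm_nonneg _) (by positivity)
  refine (norm_sub_le _ _).trans ?_
  rw [norm_mul, norm_pow, Complex.norm_real, Real.norm_eq_abs, abs_of_nonneg hh]
  calc _ ≤ h ^ (p + 1) + h ^ (p + 1) * (Ψ * D) :=
        add_le_add (norm_expMoment_le hs hh p) (mul_le_mul_of_nonneg_left h2 (by positivity))
    _ = _ := by ring

/-- The error in propagating the old value is itself a quadrature defect, for the constant function,
so the same bound covers it. -/
theorem exp_sub_stab (R : ButcherTableau S) (s : ℂ) (h : ℝ) :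
    Complex.exp (-s * h) - R.stab (-s * h) = -s * R.defect s h 0 := by
  have h1 : toComplex (R.absc 0) = 1 := by ext i; simp [toComplex, absc]
  have h2 : Complex.exp (-s * h) = 1 - s * expMoment s h 0 := by
    have hd : ∀ x ∈ uIcc 0 h, HasDerivAt (fun x : ℝ => Complex.exp (-s * (h - x)))
        (s * (Complex.exp (-s * (h - x)) * ((x ^ 0 / (Nat.factorial 0 : ℝ) : ℝ) : ℂ))) x := by
      intro x _
      have h1 : HasDerivAt (fun x : ℝ => -s * ((h : ℂ) - (x : ℂ))) s x := by
        have := ((Complex.ofRealCLM.hasDerivAt (x := x)).const_sub (h : ℂ)).const_mul (-s)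
        simpa using this
      refine h1.cexp.congr_deriv ?_
      simp; ring
    have hc : Continuous fun x : ℝ => s * (Complex.exp (-s * (h - x)) *
      ((x ^ 0 / (Nat.factorial 0 : ℝ) : ℝ) : ℂ)) := by fun_prop
    have h2 := intervalIntegral.integral_eq_sub_of_hasDerivAt hd (hc.intervalIntegrable 0 h)
    rw [intervalIntegral.integral_const_mul] at h2
    rw [expMoment, h2]
    simp
  rw [h2, stab, defect, h1]
  ring

end ButcherTableau

/-! ### The exact linear flow, and the local error of one step. -/

theorem intervalIntegrable_exp_mul {φ : ℝ → ℂ} {T : ℝ} (hφ : ContinuousOn φ (Icc 0 T)) (s : ℂ)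
    (y : ℝ) {a b : ℝ} (ha : 0 ≤ a) (hab : a ≤ b) (hb : b ≤ T) :
    IntervalIntegrable (fun τ : ℝ => Complex.exp (-s * (y - τ)) * φ τ) volume a b := by
  refine ContinuousOn.intervalIntegrable ?_
  rw [uIcc_of_le hab]
  refine ContinuousOn.mul (by fun_prop) (hφ.mono (Icc_subset_Icc ha hb))

/-- Variation of constants over one step, in the same form as the recursion of `rkY`. -/
theorem exactY_add {φ : ℝ → ℂ} {T : ℝ} (hφ : ContinuousOn φ (Icc 0 T)) (s : ℂ) {t h : ℝ}
    (ht : 0 ≤ t) (hh : 0 ≤ h) (hT : t + h ≤ T) :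
    exactY s φ (t + h) = Complex.exp (-s * h) * exactY s φ t
      + ∫ x in (0 : ℝ)..h, Complex.exp (-s * (h - x)) * φ (t + x) := by
  have h1 := intervalIntegrable_exp_mul hφ s (t + h) (le_refl 0) ht (by linarith)
  have h2 := intervalIntegrable_exp_mul hφ s (t + h) ht (by linarith : t ≤ t + h) hT
  rw [exactY, exactY]
  rw [← intervalIntegral.integral_add_adjacent_intervals h1 h2,
    ← intervalIntegral.integral_const_mul]
  congr 1
  · refine intervalIntegral.integral_congr fun τ _ => ?_
    rw [← mul_assoc, ← Complex.exp_add]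
    congr 2
    push_cast
    ring
  · have := intervalIntegral.integral_comp_add_left
      (fun τ : ℝ => Complex.exp (-s * (((t + h : ℝ) : ℂ) - τ)) * φ τ) t (a := 0) (b := h)
    rw [add_zero] at this
    rw [← this]
    refine intervalIntegral.integral_congr fun τ _ => ?_
    congr 2
    push_cast
    ring

theorem norm_exactY_le {φ : ℝ → ℂ} {T Φ : ℝ} (hφ : ∀ x ∈ Icc 0 T, ‖φ x‖ ≤ Φ) {s : ℂ}
    (hs : 0 ≤ s.re) {t : ℝ} (ht : t ∈ Icc 0 T) : ‖exactY s φ t‖ ≤ Φ * t := by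
  have := intervalIntegral.norm_integral_le_of_norm_le_const (a := 0) (b := t) (C := Φ)
    (f := fun x : ℝ => Complex.exp (-s * (t - x)) * φ x) (by
      intro x hx
      rw [uIoc_of_le ht.1] at hx
      rw [norm_mul]
      calc _ ≤ 1 * ‖φ x‖ :=
            mul_le_mul_of_nonneg_right (norm_exp_neg_mul_le_one hs hx.2) (norm_nonneg _)
        _ ≤ Φ := by rw [one_mul]; exact hφ x ⟨hx.1.le, hx.2.trans ht.2⟩)
  rw [sub_zero, abs_of_nonneg ht.1] at this
  exact this

namespace ButcherTableau

variable {S : ℕ}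

/-- The local error of one Runge-Kutta step with exact stage values. -/
theorem HasOrder.exists_local_error_bound {R : ButcherTableau S} {p : ℕ} (hp : R.HasOrder p)
    (hR : R.HasPositiveSpectrum) (hc : ∀ i, 0 ≤ R.c i ∧ R.c i ≤ 1) {T : ℝ} (hT : 0 < T)
    {φ : ℝ → ℂ} (hφ : ContDiffOn ℝ p φ (Icc 0 T)) (σ : ℝ) :
    ∃ C : ℝ, 0 ≤ C ∧ ∀ (s : ℂ) (t h : ℝ), 0 ≤ s.re → ‖s‖ ≤ σ → 0 ≤ t → 0 ≤ h → t + h ≤ T →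
      ‖s * h‖ ≤ 1 →
      ‖exactY s φ (t + h) - (R.stab (-s * h) * exactY s φ t
        + h * dotProduct (R.psi (-s * h)) (fun i => φ (t + R.c i * h)))‖ ≤ C * h ^ (p + 1) := by
  obtain ⟨Ψ, hΨ0, hΨ⟩ := hR.exists_psi_bound
  obtain ⟨D, hD0, hD⟩ := hp.exists_defect_bound hR σ
  obtain ⟨A, hA0, hA⟩ := exists_taylor_bound hT p hφ
  obtain ⟨Φ, hΦ⟩ := isCompact_Icc.exists_bound_of_continuousOn hφ.continuousOn
  have hΦ0 : 0 ≤ Φ := (norm_nonneg _).trans (hΦ 0 ⟨le_rfl, hT.le⟩)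
  -- The summands bound, in order: propagation of the old value, the Taylor polynomial, the
  -- remainder under the integral, and the remainder in the quadrature (`b1` to `b4`).
  refine ⟨|σ| * D * (Φ * T) + p * (A * D) + A + Ψ * A, by positivity,
    fun s t h hs hsσ ht hh hthT hsh => ?_⟩
  have hz : (-s * (h : ℂ)).re ≤ 0 := by
    rw [Complex.re_mul_ofReal, Complex.neg_re]; nlinarith
  obtain ⟨a, ha, hrem⟩ := hA t ⟨ht, by linarith⟩
  let ρ : ℝ → ℂ := fun x => φ (t + x) - ∑ k ∈ Finset.range p,
        a k * ((x ^ k / (k.factorial : ℝ) : ℝ) : ℂ)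
  have hρ : ∀ x ∈ Icc 0 h, ‖ρ x‖ ≤ A * h ^ p := by
    intro x hx
    have := hrem (t + x) ⟨by linarith [hx.1], by linarith [hx.2]⟩
    rw [add_sub_cancel_left, abs_of_nonneg hx.1] at this
    exact this.trans (mul_le_mul_of_nonneg_left (pow_le_pow_left₀ hx.1 hx.2 _) hA0)
  have hφt : ContinuousOn (fun x => φ (t + x)) (uIcc 0 h) := by
    refine hφ.continuousOn.comp (by fun_prop) ?_
    intro x hx
    rw [uIcc_of_le hh] at hx
    exact ⟨by linarith [hx.1], by linarith [hx.2]⟩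
  have hρc : ContinuousOn ρ (uIcc 0 h) := hφt.sub (by fun_prop)
  have e1 : ∫ x in (0 : ℝ)..h, Complex.exp (-s * (h - x)) * φ (t + x)
      = ∑ k ∈ Finset.range p, a k * expMoment s h k
        + ∫ x in (0 : ℝ)..h, Complex.exp (-s * (h - x)) * ρ x := by
    have hi : ∀ k ∈ Finset.range p, IntervalIntegrable (fun x : ℝ => a k *
        (Complex.exp (-s * (h - x)) * ((x ^ k / (k.factorial : ℝ) : ℝ) : ℂ))) volume 0 h := by
      intro k _
      refine Continuous.intervalIntegrable ?_ _ _
      fun_prop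
    simp only [expMoment]
    simp_rw [← intervalIntegral.integral_const_mul]
    rw [← intervalIntegral.integral_finsetSum hi, ← intervalIntegral.integral_add]
    · refine intervalIntegral.integral_congr fun x _ => ?_
      simp only [ρ]
      rw [mul_sub _ (φ (t + x)), Finset.mul_sum, ← add_sub_assoc, eq_sub_iff_add_eq, add_comm]
      congr 1
      exact Finset.sum_congr rfl fun k _ => by ring
    · refine Continuous.intervalIntegrable ?_ _ _
      fun_prop
    · exact (ContinuousOn.mul (by fun_prop) hρc).intervalIntegrable
  have e2 : (h : ℂ) * dotProduct (R.psi (-s * h)) (fun i => φ (t + R.c i * h))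
      = ∑ k ∈ Finset.range p, a k * ((h : ℂ) ^ (k + 1) *
          dotProduct (R.psi (-s * h)) (toComplex (R.absc k)))
        + h * dotProduct (R.psi (-s * h)) (fun i => ρ (R.c i * h)) := by
    have : (fun i => φ (t + R.c i * h)) = (∑ k ∈ Finset.range p,
        (a k * (h : ℂ) ^ k) • toComplex (R.absc k)) + fun i => ρ (R.c i * h) := by
      ext i
      simp only [ρ, Pi.add_apply, Finset.sum_apply, Pi.smul_apply, smul_eq_mul, toComplex, absc]
      rw [← add_sub_assoc, eq_sub_iff_add_eq, add_comm]
      congr 1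
      refine Finset.sum_congr rfl fun k _ => ?_
      push_cast
      ring
    rw [this, dotProduct_add, dotProduct_sum, mul_add, Finset.mul_sum]
    congr 1
    refine Finset.sum_congr rfl fun k _ => ?_
    rw [dotProduct_smul, smul_eq_mul]
    ring
  have e3 : exactY s φ (t + h) - (R.stab (-s * h) * exactY s φ t
        + h * dotProduct (R.psi (-s * h)) (fun i => φ (t + R.c i * h)))
      = -s * R.defect s h 0 * exactY s φ t + ∑ k ∈ Finset.range p, a k * R.defect s h k
        + (∫ x in (0 : ℝ)..h, Complex.exp (-s * (h - x)) * ρ x)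
        - h * dotProduct (R.psi (-s * h)) (fun i => ρ (R.c i * h)) := by
    rw [exactY_add hφ.continuousOn s ht hh hthT, e1, e2, ← R.exp_sub_stab]
    simp only [defect, mul_sub, Finset.sum_sub_distrib]
    ring
  have b1 : ‖-s * R.defect s h 0 * exactY s φ t‖ ≤ |σ| * D * (Φ * T) * h ^ (p + 1) := by
    rw [norm_mul, norm_mul, norm_neg]
    calc _ ≤ |σ| * (D * h ^ (p + 1)) * (Φ * T) := by
          gcongr
          · exact hsσ.trans (le_abs_self _)
          · exact hD s h hs hsσ hh hsh 0 (Nat.zero_le _)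
          · exact (norm_exactY_le hΦ hs ⟨ht, by linarith⟩).trans (by gcongr; linarith)
      _ = _ := by ring
  have b2 : ‖∑ k ∈ Finset.range p, a k * R.defect s h k‖ ≤ p * (A * D) * h ^ (p + 1) := by
    have : ∀ k ∈ Finset.range p, ‖a k * R.defect s h k‖ ≤ A * (D * h ^ (p + 1)) := by
      intro k hk
      rw [norm_mul]
      exact mul_le_mul (ha k) (hD s h hs hsσ hh hsh k (Finset.mem_range.1 hk).le) (norm_nonneg _) hA0
    refine (norm_sum_le_of_le _ this).trans (le_of_eq ?_)
    rw [Finset.sum_const, Finset.card_range, nsmul_eq_mul]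
    ring
  have b3 : ‖∫ x in (0 : ℝ)..h, Complex.exp (-s * (h - x)) * ρ x‖ ≤ A * h ^ (p + 1) := by
    have := intervalIntegral.norm_integral_le_of_norm_le_const (a := 0) (b := h) (C := A * h ^ p)
      (f := fun x : ℝ => Complex.exp (-s * (h - x)) * ρ x) (by
        intro x hx
        rw [uIoc_of_le hh] at hx
        rw [norm_mul]
        calc _ ≤ 1 * ‖ρ x‖ :=
              mul_le_mul_of_nonneg_right (norm_exp_neg_mul_le_one hs hx.2) (norm_nonneg _)
          _ ≤ _ := by rw [one_mul]; exact hρ x ⟨hx.1.le, hx.2⟩)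
    rw [sub_zero, abs_of_nonneg hh] at this
    refine this.trans (le_of_eq (by ring))
  have b4 : ‖(h : ℂ) * dotProduct (R.psi (-s * h)) (fun i => ρ (R.c i * h))‖
      ≤ Ψ * A * h ^ (p + 1) := by
    rw [norm_mul, Complex.norm_real, Real.norm_eq_abs, abs_of_nonneg hh]
    calc _ ≤ h * (Ψ * (A * h ^ p)) := by
          gcongr
          refine R.norm_psi_dotProduct_le (hΨ _ hz (by simpa using hsh)) (by positivity) fun i => ?_
          exact hρ _ ⟨mul_nonneg (hc i).1 hh, mul_le_of_le_one_left hh (hc i).2⟩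
      _ = _ := by ring
  rw [e3]
  refine (norm_sub_le _ _).trans ?_
  refine (add_le_add ((norm_add_le _ _).trans (add_le_add ((norm_add_le _ _).trans
    (add_le_add b1 b2)) b3)) b4).trans (le_of_eq (by ring))

end ButcherTableau

/-! ### Interpolated stages, the error recursion and the Runge–Kutta error. -/

/-- The error of the interpolated stage values. -/
theorem exists_stageVec_bound {S m : ℕ} (R : ButcherTableau S) (hc : ∀ i, 0 ≤ R.c i ∧ R.c i ≤ 1)
    (hm : 1 ≤ m) {L : ℕ} {w : ℕ → Fin S → Fin m → ℝ}
    (hw : IsInterpolationOfOrder R w L) {T : ℝ} (hT : 0 < T) {φ : ℝ → ℂ}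
    (hφ : ContDiffOn ℝ L φ (Icc 0 T)) :
    ∃ C : ℝ, 0 ≤ C ∧ ∀ (h β : ℝ) (j : ℕ) (G : ℕ → ℂ), 0 ≤ h → (topNode m j : ℝ) * h ≤ T →
      (∀ k ≤ topNode m j, ‖φ (k * h) - G k‖ ≤ β) →
      ∀ i, ‖φ (j * h + R.c i * h) - stageVec R w G j i‖ ≤ C * (h ^ L + β) := by
  obtain ⟨A, hA0, hA⟩ := exists_taylor_bound hT L hφ
  let W : ℝ := ∑ δ ∈ Finset.range (m - 2 + 1), ∑ i, ∑ k, |w δ i k|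
  have hW0 : 0 ≤ W := by positivity
  -- The `1` serves integer stages. For internal stages, `A` is the Taylor remainder at the stage,
  -- `W * (A * m ^ L)` the remainders at nodes within distance `m h` of `t_j`, and `W` the
  -- amplification of errors in the data.
  refine ⟨1 + A + W * (A * m ^ L) + W, by positivity, fun h β j G hh hT' hG i => ?_⟩
  have hjt : j + 1 ≤ topNode m j := le_max_left _ _
  have hβ : 0 ≤ β := (norm_nonneg _).trans (hG 0 (Nat.zero_le _))
  have hC1 : β ≤ (1 + A + W * (A * m ^ L) + W) * (h ^ L + β) := by
    have h1 : 0 ≤ h ^ L := pow_nonneg hh _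
    have h2 : 0 ≤ A + W * (A * m ^ L) + W := by positivity
    nlinarith [mul_nonneg h2 (add_nonneg h1 hβ)]
  unfold stageVec
  split_ifs with h0 h1
  · rw [h0, zero_mul, add_zero]
    exact (hG j (by omega)).trans hC1
  · rw [h1, one_mul]
    have := hG (j + 1) hjt
    push_cast at this
    rw [add_mul, one_mul] at this
    exact this.trans hC1
  · have hc0 : 0 < R.c i := lt_of_le_of_ne (hc i).1 (Ne.symm h0)
    have hc1 : R.c i < 1 := lt_of_le_of_ne (hc i).2 h1
    set t := topNode m j with ht
    set δ := t - (j + 1) with hδ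
    have hδm : δ ≤ m - 2 := by
      simp only [topNode] at ht; omega
    have hmt : m ≤ t + 1 := by simp only [topNode] at ht; omega
    have htj : (t : ℝ) = j + 1 + δ := by
      have : t = j + 1 + δ := by omega
      rw [this]; push_cast; ring
    have hjT : ((j : ℝ) + 1) * h ≤ T := by
      refine le_trans ?_ hT'
      gcongr
      exact_mod_cast hjt
    have hj0 : (j : ℝ) * h ∈ Icc 0 T := ⟨by positivity, by nlinarith⟩
    obtain ⟨a, ha, hrem⟩ := hA _ hj0
    let P : ℝ → ℂ := fun x => ∑ k ∈ Finset.range L,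
        a k * (((x - j * h) ^ k / (k.factorial : ℝ) : ℝ) : ℂ)
    have hwsum : ∑ k, |w δ i k| ≤ W := by
      refine (Finset.single_le_sum (f := fun i => ∑ k, |w δ i k|)
        (fun _ _ => by positivity) (Finset.mem_univ i)).trans ?_
      exact Finset.single_le_sum (f := fun δ => ∑ i, ∑ k, |w δ i k|)
        (fun _ _ => by positivity) (Finset.mem_range.2 (by omega : δ < m - 2 + 1))
    -- Measured from `t_j` in units of `h`, the nodes lie at `1 + δ - k` and the stage at `c_i`, so
    -- exactness on the powers `e < L` reproduces the Taylor polynomial.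
    have hrep : ∑ k : Fin m, (w δ i k : ℂ) * P ((t - k : ℕ) * h) = P (j * h + R.c i * h) := by
      simp only [P, Finset.mul_sum]
      rw [Finset.sum_comm]
      refine Finset.sum_congr rfl fun e he => ?_
      have hwe := hw δ hδm i hc0 hc1 e (Finset.mem_range.1 he)
      rw [add_sub_cancel_left, mul_pow, ← hwe, Finset.sum_mul, Finset.sum_div]
      push_cast
      rw [Finset.mul_sum]
      refine Finset.sum_congr rfl fun k _ => ?_
      have hk : ((t - k : ℕ) : ℂ) = t - (k : ℕ) := by
        rw [Nat.cast_sub (by have := k.2; omega)]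
      have htj' : (t : ℂ) = j + 1 + δ := by exact_mod_cast congrArg (fun x : ℝ => (x : ℂ)) htj
      rw [hk, htj', show ((j : ℂ) + 1 + δ - (k : ℕ)) * h - j * h = (1 + δ - (k : ℕ)) * h by ring,
        mul_pow]
      ring
    have hnode : ∀ k : Fin m, ‖φ ((t - k : ℕ) * h) - P ((t - k : ℕ) * h)‖ ≤ A * (m * h) ^ L := by
      intro k
      have hkt : ((t - (k : ℕ) : ℕ) : ℝ) = t - (k : ℕ) := Nat.cast_sub (by have := k.2; omega)
      have hmem : ((t - k : ℕ) : ℝ) * h ∈ Icc 0 T := by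
        refine ⟨by positivity, le_trans ?_ hT'⟩
        gcongr
        exact Nat.sub_le _ _
      refine (hrem _ hmem).trans ?_
      refine mul_le_mul_of_nonneg_left (pow_le_pow_left₀ (abs_nonneg _) ?_ _) hA0
      rw [hkt, htj, show ((j : ℝ) + 1 + δ - (k : ℕ)) * h - j * h = (1 + δ - (k : ℕ)) * h by ring,
        abs_mul, abs_of_nonneg hh]
      gcongr
      rw [abs_le]
      have hkm : ((k : ℕ) : ℝ) + 1 ≤ m := by exact_mod_cast k.2
      have hδ1 : (δ : ℝ) + 1 ≤ m := by exact_mod_cast (by omega : δ + 1 ≤ m)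
      constructor
      · linarith [(Nat.cast_nonneg δ : (0 : ℝ) ≤ δ)]
      · linarith [(Nat.cast_nonneg (k : ℕ) : (0 : ℝ) ≤ (k : ℕ))]
    have hpt : ‖φ (j * h + R.c i * h) - P (j * h + R.c i * h)‖ ≤ A * h ^ L := by
      refine (hrem _ ⟨by have := hj0.1; positivity, by nlinarith⟩).trans ?_
      refine mul_le_mul_of_nonneg_left (pow_le_pow_left₀ (abs_nonneg _) ?_ _) hA0
      rw [add_sub_cancel_left, abs_of_nonneg (by positivity)]
      exact mul_le_of_le_one_left hh (hc i).2
    have e : φ (j * h + R.c i * h) - ∑ k : Fin m, (w δ i k : ℂ) * G (t - k)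
        = (φ (j * h + R.c i * h) - P (j * h + R.c i * h))
          + ∑ k : Fin m, (w δ i k : ℂ) * ((φ ((t - k : ℕ) * h) - G (t - k))
            - (φ ((t - k : ℕ) * h) - P ((t - k : ℕ) * h))) := by
      have : ∑ k : Fin m, (w δ i k : ℂ) * ((φ ((t - k : ℕ) * h) - G (t - k))
            - (φ ((t - k : ℕ) * h) - P ((t - k : ℕ) * h)))
          = ∑ k : Fin m, (w δ i k : ℂ) * P ((t - k : ℕ) * h)
            - ∑ k : Fin m, (w δ i k : ℂ) * G (t - k) := by
        rw [← Finset.sum_sub_distrib]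
        exact Finset.sum_congr rfl fun k _ => by ring
      rw [this, hrep]
      ring
    have hsum : ‖∑ k : Fin m, (w δ i k : ℂ) * ((φ ((t - k : ℕ) * h) - G (t - k))
            - (φ ((t - k : ℕ) * h) - P ((t - k : ℕ) * h)))‖ ≤ W * (β + A * (m * h) ^ L) := by
      refine (norm_sum_le_of_le _ (n := fun k => |w δ i k| * (β + A * (m * h) ^ L))
        fun k _ => ?_).trans ?_
      · rw [norm_mul, Complex.norm_real, Real.norm_eq_abs]
        exact mul_le_mul_of_nonneg_left ((norm_sub_le _ _).trans
          (add_le_add (hG _ (Nat.sub_le _ _)) (hnode k))) (abs_nonneg _)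
      · rw [← Finset.sum_mul]
        exact mul_le_mul_of_nonneg_right hwsum (by positivity)
    rw [e]
    refine ((norm_add_le _ _).trans (add_le_add hpt hsum)).trans ?_
    rw [mul_pow]
    have h1 : 0 ≤ h ^ L := pow_nonneg hh _
    have h2 : 0 ≤ (A + W * (A * m ^ L)) * β := by positivity
    nlinarith [mul_nonneg hW0 h1]

/-- The recursion for the error of the Runge-Kutta method: if `β j` bounds the errors of the grid
values used in step `j`, the error after `n` steps is `O(h^p + h^L)` plus the accumulated `β j`. -/
theorem exists_rkY_bound {S m : ℕ} {R : ButcherTableau S} {p : ℕ} (hp : R.HasOrder p)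
    (hspec : R.HasPositiveSpectrum) (hstab : R.IsLStable) (hc : ∀ i, 0 ≤ R.c i ∧ R.c i ≤ 1)
    (hm : 1 ≤ m) {L : ℕ} {w : ℕ → Fin S → Fin m → ℝ}
    (hw : IsInterpolationOfOrder R w L) {T : ℝ} (hT : 0 < T) {φ : ℝ → ℂ}
    (hφp : ContDiffOn ℝ p φ (Icc 0 T)) (hφL : ContDiffOn ℝ L φ (Icc 0 T)) (σ : ℝ) :
    ∃ C : ℝ, 0 ≤ C ∧ ∀ (s : ℂ) (h : ℝ) (G : ℕ → ℂ) (β : ℕ → ℝ), 0 ≤ s.re → ‖s‖ ≤ σ → 0 ≤ h →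
      ‖s * h‖ ≤ 1 → ∀ n : ℕ, (∀ j < n, (topNode m j : ℝ) * h ≤ T) →
      (∀ j < n, ∀ k ≤ topNode m j, ‖φ (k * h) - G k‖ ≤ β j) →
      ‖exactY s φ (n * h) - rkY R w s h G n‖
        ≤ C * (n * h * (h ^ p + h ^ L) + h * ∑ j ∈ Finset.range n, β j) := by
  obtain ⟨Ψ, hΨ0, hΨ⟩ := hspec.exists_psi_bound
  obtain ⟨A, hA0, hA⟩ := hp.exists_local_error_bound hspec hc hT hφp σ
  obtain ⟨D, hD0, hD⟩ := exists_stageVec_bound R hc hm hw hT hφL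
  refine ⟨A + Ψ * D, by positivity, fun s h G β hs hsσ hh hsh n => ?_⟩
  have hz : (-s * (h : ℂ)).re ≤ 0 := by
    rw [Complex.re_mul_ofReal, Complex.neg_re]; nlinarith
  induction n with
  | zero => simp [exactY, rkY]
  | succ n ih =>
    intro htop hβ
    have hi := ih (fun j hj => htop j (by omega)) (fun j hj => hβ j (by omega))
    have hβ0 : 0 ≤ β n := (norm_nonneg _).trans (hβ n (by omega) 0 (Nat.zero_le _))
    have hnT : (n : ℝ) * h + h ≤ T := by
      refine le_trans ?_ (htop n (by omega))
      rw [← add_one_mul]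
      gcongr
      exact_mod_cast le_max_left _ _
    have hloc := hA s (n * h) h hs hsσ (by positivity) hh hnT hsh
    have hst := hD h (β n) n G hh (htop n (by omega)) (hβ n (by omega))
    have hstage : ‖(h : ℂ) * dotProduct (R.psi (-s * h))
        ((fun i => φ (n * h + R.c i * h)) - stageVec R w G n)‖ ≤ h * (Ψ * (D * (h ^ L + β n))) := by
      rw [norm_mul, Complex.norm_real, Real.norm_eq_abs, abs_of_nonneg hh]
      exact mul_le_mul_of_nonneg_left (R.norm_psi_dotProduct_le (hΨ _ hz (by simpa using hsh))
        (by positivity) hst) hh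
    have e : exactY s φ ((n + 1 : ℕ) * h) - rkY R w s h G (n + 1)
        = (exactY s φ (n * h + h) - (R.stab (-s * h) * exactY s φ (n * h)
          + h * dotProduct (R.psi (-s * h)) (fun i => φ (n * h + R.c i * h))))
          + R.stab (-s * h) * (exactY s φ (n * h) - rkY R w s h G n)
          + (h : ℂ) * dotProduct (R.psi (-s * h))
            ((fun i => φ (n * h + R.c i * h)) - stageVec R w G n) := by
      rw [rkY, dotProduct_sub, Nat.cast_succ, add_one_mul]
      ring
    -- Stability: old errors are not amplified, so the contributions add up linearly in `n`.
    have hr : ‖R.stab (-s * h) * (exactY s φ (n * h) - rkY R w s h G n)‖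
        ≤ ‖exactY s φ (n * h) - rkY R w s h G n‖ := by
      rw [norm_mul]
      exact mul_le_of_le_one_left (norm_nonneg _) (hstab.1 _ hz)
    rw [e]
    refine ((norm_add_le _ _).trans (add_le_add ((norm_add_le _ _).trans
      (add_le_add hloc (hr.trans hi))) hstage)).trans ?_
    rw [Finset.sum_range_succ]
    push_cast
    have h1 : 0 ≤ Ψ * D * (h * h ^ p) := by positivity
    have h2 : 0 ≤ A * (h * h ^ L) := by positivity
    have h3 : 0 ≤ A * (h * β n) := by positivity
    rw [pow_succ]
    nlinarith

/-- Grid points may be end points of the interval, where the condition is not assumed; continuity of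
`g(·, v)` extends it to the closure. -/
theorem lipschitz_on_Icc {T η K : ℝ} (hT : 0 < T) {g : ℝ → ℂ → ℂ}
    (hg : ∀ v, ContinuousOn (fun τ => g τ v) (Icc 0 T))
    (hLip : ∀ τ, 0 < τ → τ < T → ∀ v₁ v₂ : ℂ, ‖v₁‖ ≤ η → ‖v₂‖ ≤ η →
      ‖g τ v₁ - g τ v₂‖ ≤ K * ‖v₁ - v₂‖) {τ : ℝ} (hτ : τ ∈ Icc 0 T) {v₁ v₂ : ℂ}
    (h₁ : ‖v₁‖ ≤ η) (h₂ : ‖v₂‖ ≤ η) : ‖g τ v₁ - g τ v₂‖ ≤ |K| * ‖v₁ - v₂‖ := by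
  have hcl : closure (Ioo 0 T) = Icc 0 T := closure_Ioo hT.ne
  refine le_on_closure (s := Ioo 0 T) (f := fun τ => ‖g τ v₁ - g τ v₂‖)
    (g := fun _ => |K| * ‖v₁ - v₂‖) (fun τ hτ => ?_) ?_ continuousOn_const (hcl ▸ hτ)
  · exact (hLip τ hτ.1 hτ.2 v₁ v₂ h₁ h₂).trans
      (mul_le_mul_of_nonneg_right (le_abs_self K) (norm_nonneg _))
  · rw [hcl]
    exact ((hg v₁).sub (hg v₂)).norm

/-- The bound of the Runge-Kutta error. -/
theorem exists_rkError_bound {S m : ℕ} {R : ButcherTableau S} {p : ℕ} (hp : R.HasOrder p)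
    (hspec : R.HasPositiveSpectrum) (hstab : R.IsLStable) (hc : ∀ i, 0 ≤ R.c i ∧ R.c i ≤ 1)
    (hm : 1 ≤ m) {L : ℕ} {w : ℕ → Fin S → Fin m → ℝ}
    (hw : IsInterpolationOfOrder R w L) {T : ℝ} (hT : 0 < T) {u : ℝ → ℂ} {g : ℝ → ℂ → ℂ}
    (hφp : ContDiffOn ℝ p (fun τ => g τ (u τ)) (Icc 0 T))
    (hφL : ContDiffOn ℝ L (fun τ => g τ (u τ)) (Icc 0 T))
    {η K : ℝ} (huη : ∀ t ∈ Icc 0 T, ‖u t‖ ≤ η)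
    (hLip : ∀ τ ∈ Icc 0 T, ∀ v₁ v₂ : ℂ, ‖v₁‖ ≤ η → ‖v₂‖ ≤ η →
      ‖g τ v₁ - g τ v₂‖ ≤ |K| * ‖v₁ - v₂‖) (σ μ : ℝ) :
    ∃ C₂ : ℝ, ∀ (E : SOE) (h : ℝ) (n₀ NT : ℕ) (U : ℕ → ℂ),
      0 < h → (NT * h : ℝ) ≤ T → m ≤ NT + 1 →
      E.IsBoundedBy (n₀ * h) σ μ → (∀ l, ‖E.s l * h‖ ≤ 1) →
      (∀ j ≤ NT, ‖U j‖ ≤ η) →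
      ∀ l, ‖rkError R w E g u U (n₀ * h) h NT l‖ ≤
        C₂ * ((Finset.range (NT + 1)).sup' Finset.nonempty_range_add_one
          (fun j => ‖U j - u (j * h)‖) + h ^ p + h ^ L) := by
  obtain ⟨C, hC0, hC⟩ := exists_rkY_bound hp hspec hstab hc hm hw hT hφp hφL σ
  refine ⟨|μ| * (C * (T * (1 + |K|))), fun E h n₀ NT U hh hNT hmN hE hEh hU l => ?_⟩
  set X := (Finset.range (NT + 1)).sup' Finset.nonempty_range_add_one
    (fun j => ‖U j - u (j * h)‖) with hX
  have hXj : ∀ j ≤ NT, ‖U j - u (j * h)‖ ≤ X := fun j hj =>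
    Finset.le_sup' (fun j : ℕ => ‖U j - u (j * h)‖) (Finset.mem_range.2 (by omega))
  have hX0 : 0 ≤ X := (norm_nonneg _).trans (hXj 0 (Nat.zero_le _))
  -- This is where `m - 1 ≤ N_T` matters: the starting stencils reach up to index `m - 1`.
  have htop : ∀ j < NT, topNode m j ≤ NT := fun j hj => max_le (by omega) (by omega)
  have hmem : ∀ k ≤ NT, (k : ℝ) * h ≤ T := fun k hk => by
    refine le_trans ?_ hNT
    gcongr
  have hb := hC (E.s l) h (fun k => g (k * h) (U k)) (fun _ => |K| * X) (E.re_nonneg l) (hE.1 l)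
    hh.le (hEh l) NT (fun j hj => hmem _ (htop j hj)) (fun j hj k hk => by
      have hk' := hk.trans (htop j hj)
      have hkm : (k : ℝ) * h ∈ Icc 0 T := ⟨by positivity, hmem k hk'⟩
      refine (hLip _ hkm _ _ (huη _ hkm) (hU k hk')).trans ?_
      rw [norm_sub_rev]
      exact mul_le_mul_of_nonneg_left (hXj k hk') (abs_nonneg _))
  have hM : ‖E.M (n₀ * h) l‖ ≤ |μ| :=
    ((Finset.single_le_sum (f := fun l => ‖E.M (n₀ * h) l‖) (fun _ _ => norm_nonneg _)
      (Finset.mem_univ l)).trans hE.2).trans (le_abs_self _)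
  rw [rkError, norm_mul, mul_assoc]
  refine mul_le_mul hM (hb.trans ?_) (norm_nonneg _) (abs_nonneg _)
  rw [mul_assoc C]
  refine mul_le_mul_of_nonneg_left ?_ hC0
  rw [Finset.sum_const, Finset.card_range, nsmul_eq_mul]
  have hpL : 0 ≤ h ^ p + h ^ L := by positivity
  have hKX : 0 ≤ |K| * X := by positivity
  calc NT * h * (h ^ p + h ^ L) + h * (NT * (|K| * X))
      = NT * h * (h ^ p + h ^ L + |K| * X) := by ring
    _ ≤ T * (h ^ p + h ^ L + |K| * X) := by gcongr
    _ ≤ T * ((1 + |K|) * (X + h ^ p + h ^ L)) := by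
        refine mul_le_mul_of_nonneg_left ?_ hT.le
        nlinarith [mul_nonneg (abs_nonneg K) hpL]
    _ = _ := by ring

/-! Local interpolation -/

/-- In the variable `x / h` distinct nodes differ by at least 1, so every factor of the basis
polynomial is at most `L`, independently of `h`. -/
theorem norm_eval_lagrangeBasis_le {L : ℕ} (hL : 1 ≤ L) (n : ℕ) {y : ℝ} (hy0 : 0 ≤ y - n)
    (hyL : y - n ≤ L) {k : ℕ} :
    ‖(Lagrange.basis (Finset.range L) (fun k => ((n + k : ℕ) : ℂ)) k).eval (y : ℂ)‖
      ≤ (L : ℝ) ^ L := by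
  have hL1 : (1 : ℝ) ≤ L := by exact_mod_cast hL
  rw [Lagrange.basis, Polynomial.eval_prod, norm_prod]
  calc _ ≤ ∏ j ∈ (Finset.range L).erase k, (L : ℝ) := by
        refine Finset.prod_le_prod (fun _ _ => norm_nonneg _) fun j hj => ?_
        rw [Finset.mem_erase, Finset.mem_range] at hj
        rw [Lagrange.basisDivisor, Polynomial.eval_mul, Polynomial.eval_C, Polynomial.eval_sub,
          Polynomial.eval_X, Polynomial.eval_C, norm_mul, norm_inv]
        have h1 : 1 ≤ ‖((n + k : ℕ) : ℂ) - ((n + j : ℕ) : ℂ)‖ := by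
          have : ((n + k : ℕ) : ℂ) - ((n + j : ℕ) : ℂ) = (((k : ℤ) - (j : ℤ) : ℤ) : ℂ) := by
            push_cast; ring
          rw [this, Complex.norm_intCast]
          have h2 : 1 ≤ |(k : ℤ) - j| := Int.one_le_abs (by omega)
          exact_mod_cast h2
        have h2 : ‖(y : ℂ) - ((n + j : ℕ) : ℂ)‖ ≤ L := by
          have : (y : ℂ) - ((n + j : ℕ) : ℂ) = ((y - n - j : ℝ) : ℂ) := by push_cast; ring
          rw [this, Complex.norm_real, Real.norm_eq_abs, abs_le]
          have hj' : (j : ℝ) ≤ L := by exact_mod_cast hj.2.le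
          constructor <;> linarith [(Nat.cast_nonneg j : (0 : ℝ) ≤ j)]
        calc _ ≤ 1 * (L : ℝ) := mul_le_mul (inv_le_one_of_one_le₀ h1) h2 (norm_nonneg _) zero_le_one
          _ = L := one_mul _
    _ = (L : ℝ) ^ ((Finset.range L).erase k).card := by rw [Finset.prod_const]
    _ ≤ (L : ℝ) ^ L := pow_le_pow_right₀ hL1 (by
        simpa using Finset.card_erase_le (s := Finset.range L) (a := k))

theorem eval_lagrangeInterpolate {L n : ℕ} (r : ℕ → ℂ) (y : ℂ) :
    (Lagrange.interpolate (Finset.range L) (fun k => ((n + k : ℕ) : ℂ)) r).eval y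
      = ∑ k ∈ Finset.range L, r k *
        (Lagrange.basis (Finset.range L) (fun k => ((n + k : ℕ) : ℂ)) k).eval y := by
  rw [Lagrange.interpolate_apply, Polynomial.eval_finsetSum]
  simp only [Polynomial.eval_mul, Polynomial.eval_C]

theorem sum_lagrangeBasis_of_degree_lt {L n : ℕ} {Q : Polynomial ℂ} (hQ : Q.degree < L) (y : ℂ) :
    ∑ k ∈ Finset.range L, Q.eval ((n + k : ℕ) : ℂ) *
      (Lagrange.basis (Finset.range L) (fun k => ((n + k : ℕ) : ℂ)) k).eval y = Q.eval y := by
  have hinj : Set.InjOn (fun k : ℕ => ((n + k : ℕ) : ℂ)) (Finset.range L) := by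
    intro a _ b _ hab
    simpa using hab
  rw [← eval_lagrangeInterpolate (fun k => Q.eval ((n + k : ℕ) : ℂ)),
    ← Lagrange.eq_interpolate (v := fun k : ℕ => ((n + k : ℕ) : ℂ)) hinj (by simpa using hQ)]

/-- The error of the local interpolant built from perturbed grid values. -/
theorem exists_localInterp_bound {L : ℕ} (hL : 1 ≤ L) {T : ℝ} (hT : 0 < T) {φ : ℝ → ℂ}
    (hφ : ContDiffOn ℝ L φ (Icc 0 T)) :
    ∃ C : ℝ, 0 ≤ C ∧ ∀ (h β x : ℝ) (n : ℕ → ℕ) (G : ℕ → ℂ), 0 < h → x ∈ Icc 0 T →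
      n ⌊x / h⌋₊ ≤ ⌊x / h⌋₊ → ⌊x / h⌋₊ + 1 < n ⌊x / h⌋₊ + max L 2 →
      (∀ k < L, ((n ⌊x / h⌋₊ + k : ℕ) : ℝ) * h ≤ T) →
      (∀ k < L, ‖φ ((n ⌊x / h⌋₊ + k : ℕ) * h) - G (n ⌊x / h⌋₊ + k)‖ ≤ β) →
      ‖φ x - localInterp L n h G x‖ ≤ C * (h ^ L + β) := by
  obtain ⟨A, hA0, hA⟩ := exists_taylor_bound hT L hφ
  refine ⟨L * (A * L ^ L + 1) * L ^ L, by positivity,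
    fun h β x ν G hh hx hν1 hν2 hνT hG => ?_⟩
  obtain ⟨a, ha, hrem⟩ := hA x hx
  set j := ⌊x / h⌋₊ with hj
  set n := ν j with hn
  have hβ0 : 0 ≤ β := (norm_nonneg _).trans (hG 0 hL)
  have hjx : (j : ℝ) ≤ x / h := Nat.floor_le (div_nonneg hx.1 hh.le)
  have hxj : x / h < j + 1 := Nat.lt_floor_add_one _
  have hy0 : 0 ≤ x / h - n := by
    have : (n : ℝ) ≤ j := by exact_mod_cast hν1
    linarith
  have hyL : x / h - n ≤ L := by
    have : (j : ℝ) + 1 ≤ n + L := by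
      have : j + 1 ≤ n + L := by omega
      exact_mod_cast this
    linarith
  have hxh : x = x / h * h := by field_simp
  -- The Taylor polynomial is centred at the evaluation point `x`, in the variable `x / h`. It is
  -- exact there because `L ≥ 1`, so only errors at the nodes contribute.
  let Q : Polynomial ℂ := ∑ k ∈ Finset.range L, Polynomial.C (a k / (k.factorial : ℂ)) *
    (Polynomial.C (h : ℂ) * Polynomial.X - Polynomial.C (x : ℂ)) ^ k
  have hQdeg : Q.degree < L := by
    rw [← Polynomial.mem_degreeLT]
    refine Submodule.sum_mem _ fun k hk => ?_
    rw [Polynomial.mem_degreeLT]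
    rw [Finset.mem_range] at hk
    have h1 : (Polynomial.C (h : ℂ) * Polynomial.X - Polynomial.C (x : ℂ)).natDegree ≤ 1 := by
      compute_degree
    have h2 : (Polynomial.C (a k / (k.factorial : ℂ)) *
        (Polynomial.C (h : ℂ) * Polynomial.X - Polynomial.C (x : ℂ)) ^ k).natDegree ≤ k := by
      refine (Polynomial.natDegree_C_mul_le _ _).trans ?_
      exact (Polynomial.natDegree_pow_le_of_le k h1).trans (by omega)
    exact (Polynomial.degree_le_of_natDegree_le h2).trans_lt (by exact_mod_cast hk)
  have hQeval : ∀ y : ℝ, Q.eval (y : ℂ) = ∑ k ∈ Finset.range L,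
      a k * (((y * h - x) ^ k / (k.factorial : ℝ) : ℝ) : ℂ) := by
    intro y
    simp only [Q, Polynomial.eval_finsetSum, Polynomial.eval_mul, Polynomial.eval_pow,
      Polynomial.eval_sub, Polynomial.eval_C, Polynomial.eval_X]
    refine Finset.sum_congr rfl fun k _ => ?_
    push_cast
    ring
  have hQx : Q.eval ((x / h : ℝ) : ℂ) = φ x := by
    have h1 := hrem x hx
    rw [sub_self, abs_zero, zero_pow (by omega), mul_zero, norm_le_zero_iff, sub_eq_zero] at h1
    rw [hQeval, h1]
    rw [← hxh, sub_self]
  have hnode : ∀ k < L, ‖G (n + k) - Q.eval ((n + k : ℕ) : ℂ)‖ ≤ β + A * (L * h) ^ L := by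
    intro k hk
    have h1 := hrem _ ⟨by positivity, hνT k hk⟩
    have h2 : Q.eval ((n + k : ℕ) : ℂ) = ∑ e ∈ Finset.range L,
      a e * (((((n + k : ℕ) : ℝ) * h - x) ^ e / (e.factorial : ℝ) : ℝ) : ℂ) := by
      rw [← hQeval]; push_cast; rfl
    rw [← h2] at h1
    have h3 : |((n + k : ℕ) : ℝ) * h - x| ≤ L * h := by
      have hk' : (k : ℝ) ≤ L := by exact_mod_cast hk.le
      rw [show ((n + k : ℕ) : ℝ) * h - x = (k - (x / h - n)) * h by
        push_cast; field_simp; ring, abs_mul, abs_of_pos hh]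
      refine mul_le_mul_of_nonneg_right ?_ hh.le
      rw [abs_le]
      constructor <;> linarith [(Nat.cast_nonneg k : (0 : ℝ) ≤ k)]
    calc _ = ‖-(φ ((n + k : ℕ) * h) - G (n + k)) + (φ ((n + k : ℕ) * h) - Q.eval ((n + k : ℕ) : ℂ))‖ := by
          congr 1; ring
      _ ≤ β + A * (L * h) ^ L := by
          refine (norm_add_le _ _).trans (add_le_add ?_ (h1.trans ?_))
          · rw [norm_neg]; exact hG k hk
          · exact mul_le_mul_of_nonneg_left (pow_le_pow_left₀ (abs_nonneg _) h3 _) hA0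
  have e : localInterp L ν h G x - φ x = ∑ k ∈ Finset.range L,
      (G (n + k) - Q.eval ((n + k : ℕ) : ℂ)) *
        (Lagrange.basis (Finset.range L) (fun k => ((n + k : ℕ) : ℂ)) k).eval ((x / h : ℝ) : ℂ) := by
    simp only [sub_mul, Finset.sum_sub_distrib]
    rw [sum_lagrangeBasis_of_degree_lt hQdeg, hQx, localInterp, ← hj, ← hn,
      eval_lagrangeInterpolate (fun k => G (n + k))]
  rw [norm_sub_rev, e]
  refine (norm_sum_le_of_le _ (n := fun _ => (β + A * (L * h) ^ L) * (L : ℝ) ^ L)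
    fun k hk => ?_).trans ?_
  · rw [norm_mul]
    exact mul_le_mul (hnode k (Finset.mem_range.1 hk)) (norm_eval_lagrangeBasis_le hL n hy0 hyL)
      (norm_nonneg _) (by positivity)
  · rw [Finset.sum_const, Finset.card_range, nsmul_eq_mul, mul_pow]
    have h1 : 0 ≤ (L : ℝ) * L ^ L * h ^ L := by positivity
    have h2 : 0 ≤ (L : ℝ) * L ^ L * (A * L ^ L) * β := by positivity
    nlinarith

/-- The stencil depends on `x` only through the cell index, which is countable: for a fixed index
the interpolant is a polynomial. -/
theorem measurable_localInterp (L : ℕ) (n : ℕ → ℕ) (h : ℝ) (G : ℕ → ℂ) :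
    Measurable (localInterp L n h G) := by
  have h1 : Measurable (fun q : ℝ × ℕ =>
      (Lagrange.interpolate (Finset.range L) (fun k => ((n q.2 + k : ℕ) : ℂ))
        (fun k => G (n q.2 + k))).eval ((q.1 : ℝ) : ℂ)) := by
    refine measurable_from_prod_countable_left fun j => ?_
    exact (Lagrange.interpolate (Finset.range L) (fun k => ((n j + k : ℕ) : ℂ))
      (fun k => G (n j + k))).continuous.measurable.comp Complex.measurable_ofReal
  have hd : Measurable fun x : ℝ => x / h := measurable_id.div_const h
  exact h1.comp (hd.prodMk (Nat.measurable_floor.comp hd))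

/-! ### Weakly singular kernels: integrability, weights and replacement errors. -/

theorem intervalIntegrable_genTaylor {α : ℝ} (hα : α < 1) (κ : ℕ → ℂ) (M : ℕ) (a b : ℝ) :
    IntervalIntegrable (genTaylor α κ M) volume a b := by
  have h0 : IntervalIntegrable (fun τ : ℝ => τ ^ (-α)) volume a b :=
    intervalIntegral.intervalIntegrable_rpow' (by linarith)
  have h1 : IntervalIntegrable (fun τ : ℝ => ((τ ^ (-α) : ℝ) : ℂ)) volume a b :=
    ⟨h0.1.ofReal, h0.2.ofReal⟩
  refine (h1.const_mul (κ 0)).add (Continuous.intervalIntegrable ?_ _ _)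
  fun_prop

/-- An integral with an exponentially decaying weight tends to zero with the decay rate. -/
theorem tendsto_integral_mul_exp_neg {T : ℝ} (hT : 0 ≤ T) {F : ℝ → ℝ}
    (hF : IntervalIntegrable F volume 0 T) :
    Tendsto (fun r : ℝ => ∫ τ in (0 : ℝ)..T, F τ * Real.exp (-(r * τ))) atTop (𝓝 0) := by
  have h := intervalIntegral.tendsto_integral_filter_of_dominated_convergence (μ := volume)
    (l := atTop) (F := fun (r τ : ℝ) => F τ * Real.exp (-(r * τ))) (f := fun _ => (0 : ℝ))
    (a := 0) (b := T) (fun τ => |F τ|) ?_ ?_ hF.abs ?_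
  · simpa using h
  · refine Eventually.of_forall fun r => ?_
    rw [uIoc_of_le hT]
    exact hF.aestronglyMeasurable.mul (by fun_prop)
  · filter_upwards [eventually_ge_atTop 0] with r hr
    refine Eventually.of_forall fun τ hτ => ?_
    rw [uIoc_of_le hT] at hτ
    rw [norm_mul, Real.norm_eq_abs, Real.norm_eq_abs, Real.abs_exp]
    refine mul_le_of_le_one_right (abs_nonneg _) (Real.exp_le_one_iff.2 ?_)
    have := mul_nonneg hr hτ.1.le
    linarith
  · refine Eventually.of_forall fun τ hτ => ?_
    rw [uIoc_of_le hT] at hτ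
    have : Tendsto (fun r : ℝ => Real.exp (-(r * τ))) atTop (𝓝 0) :=
      Real.tendsto_exp_neg_atTop_nhds_zero.comp (tendsto_id.atTop_mul_const hτ.1)
    simpa using this.const_mul (F τ)

/-- The integral of the kernel error up to time `t`. -/
theorem exists_kernel_error_bound {T : ℝ} (hT : 0 < T) {D : ℝ → ℂ} {M : ℕ}
    (hD : IntervalIntegrable D volume 0 T) (hO : D =O[𝓝[>] 0] fun τ : ℝ => τ ^ (M + 1)) :
    ∃ C : ℝ, 0 ≤ C ∧ ∀ t ∈ Icc 0 T, ∀ r : ℝ, t ^ (M + 1) ≤ r →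
      ∫ τ in (0 : ℝ)..t, ‖D τ‖ ≤ C * r := by
  obtain ⟨c, hc0, hc⟩ := hO.exists_nonneg
  obtain ⟨δ, hδ0, hδ⟩ := (mem_nhdsGT_iff_exists_Ioo_subset).1 hc.bound
  have hδ0' : (0 : ℝ) < δ := hδ0
  have hI : 0 ≤ ∫ τ in (0 : ℝ)..T, ‖D τ‖ :=
    intervalIntegral.integral_nonneg hT.le fun _ _ => norm_nonneg _
  -- The first summand is for `t < δ`, where the asymptotic bound applies. Otherwise `r ≥ δ^(M+1)`,
  -- and the whole integral is at most a constant times `r`.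
  refine ⟨c * T + (∫ τ in (0 : ℝ)..T, ‖D τ‖) / δ ^ (M + 1), by positivity, fun t ht r hr => ?_⟩
  have hr0 : 0 ≤ r := (pow_nonneg ht.1 _).trans hr
  rw [add_mul]
  rcases lt_or_ge t δ with h | h
  · have h1 := intervalIntegral.norm_integral_le_of_norm_le_const (a := 0) (b := t)
      (C := c * t ^ (M + 1)) (f := fun τ => ‖D τ‖) (by
        intro τ hτ
        rw [uIoc_of_le ht.1] at hτ
        have h2 : ‖D τ‖ ≤ c * ‖τ ^ (M + 1)‖ := hδ ⟨hτ.1, hτ.2.trans_lt h⟩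
        rw [norm_norm]
        refine h2.trans ?_
        rw [Real.norm_eq_abs, abs_of_nonneg (pow_nonneg hτ.1.le _)]
        exact mul_le_mul_of_nonneg_left (pow_le_pow_left₀ hτ.1.le hτ.2 _) hc0)
    rw [sub_zero, abs_of_nonneg ht.1] at h1
    have h2 : c * t ^ (M + 1) * t ≤ c * r * T :=
      mul_le_mul (mul_le_mul_of_nonneg_left hr hc0) ht.2 ht.1 (mul_nonneg hc0 hr0)
    have h3 : 0 ≤ (∫ τ in (0 : ℝ)..T, ‖D τ‖) / δ ^ (M + 1) * r := by positivity
    have h4 := (le_abs_self _).trans h1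
    linarith
  · have h1 : ∫ τ in (0 : ℝ)..t, ‖D τ‖ ≤ ∫ τ in (0 : ℝ)..T, ‖D τ‖ :=
      intervalIntegral.integral_mono_interval le_rfl ht.1 ht.2
        (Eventually.of_forall fun _ => norm_nonneg _) hD.norm
    have h2 : δ ^ (M + 1) ≤ r := (pow_le_pow_left₀ hδ0'.le h _).trans hr
    have h3 : (∫ τ in (0 : ℝ)..T, ‖D τ‖) ≤ (∫ τ in (0 : ℝ)..T, ‖D τ‖) / δ ^ (M + 1) * r := by
      rw [div_mul_eq_mul_div, le_div_iff₀ (by positivity)]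
      exact mul_le_mul_of_nonneg_left h2 hI
    have h4 : 0 ≤ c * T * r := by positivity
    linarith

/-- Replacing both the kernel and the function in a convolution. -/
theorem norm_integral_mul_sub_integral_mul_le {t Φ : ℝ} (ht : 0 ≤ t) {f F ψ π : ℝ → ℂ} {b : ℝ → ℝ}
    (hf : IntervalIntegrable f volume 0 t) (hF : IntervalIntegrable F volume 0 t)
    (hψ : ContinuousOn ψ (Icc 0 t)) (hπ : Measurable π) (hb : Continuous b)
    (hΦ : ∀ τ ∈ Icc 0 t, ‖ψ τ‖ ≤ Φ) (hψπ : ∀ τ ∈ Ioc 0 t, ‖ψ τ - π τ‖ ≤ b τ) :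
    ‖(∫ τ in (0 : ℝ)..t, f τ * ψ τ) - ∫ τ in (0 : ℝ)..t, F τ * π τ‖
      ≤ (∫ τ in (0 : ℝ)..t, ‖f τ - F τ‖) * Φ + ∫ τ in (0 : ℝ)..t, ‖F τ‖ * b τ := by
  have hψ' : ContinuousOn ψ (uIcc 0 t) := by rwa [uIcc_of_le ht]
  have hfψ : IntervalIntegrable (fun τ => f τ * ψ τ) volume 0 t := hf.mul_continuousOn hψ'
  have hFb : IntervalIntegrable (fun τ => ‖F τ‖ * b τ) volume 0 t :=
    hF.norm.mul_continuousOn hb.continuousOn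
  -- `π` is only known to be measurable; it is dominated by `Φ + b`.
  have hFπ : IntervalIntegrable (fun τ => F τ * π τ) volume 0 t := by
    refine ((hF.norm.mul_const Φ).add hFb).mono_fun' (by
      rw [uIoc_of_le ht]
      exact hF.aestronglyMeasurable.mul hπ.aestronglyMeasurable) ?_
    refine (ae_restrict_iff' measurableSet_uIoc).2 (Eventually.of_forall fun τ hτ => ?_)
    rw [uIoc_of_le ht] at hτ
    simp only
    rw [norm_mul, ← mul_add]
    refine mul_le_mul_of_nonneg_left ?_ (norm_nonneg _)
    have h1 := norm_sub_norm_le (π τ) (ψ τ)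
    rw [norm_sub_rev] at h1
    linarith [hψπ τ hτ, hΦ τ ⟨hτ.1.le, hτ.2⟩]
  have hbound : IntervalIntegrable (fun τ => ‖f τ - F τ‖ * Φ + ‖F τ‖ * b τ) volume 0 t :=
    ((hf.sub hF).norm.mul_const Φ).add hFb
  rw [← intervalIntegral.integral_sub hfψ hFπ, ← intervalIntegral.integral_mul_const,
    ← intervalIntegral.integral_add ((hf.sub hF).norm.mul_const Φ) hFb]
  refine intervalIntegral.norm_integral_le_of_norm_le ht (Eventually.of_forall fun τ hτ => ?_) hbound
  have e : f τ * ψ τ - F τ * π τ = (f τ - F τ) * ψ τ + F τ * (ψ τ - π τ) := by ring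
  rw [e]
  refine (norm_add_le _ _).trans ?_
  rw [norm_mul, norm_mul]
  exact add_le_add (mul_le_mul_of_nonneg_left (hΦ τ ⟨hτ.1.le, hτ.2⟩) (norm_nonneg _))
    (mul_le_mul_of_nonneg_left (hψπ τ hτ) (norm_nonneg _))

/-! ### The tail beyond the splitting point, and the Gronwall argument. -/

theorem SOE.continuous_eval (E : SOE) : Continuous E.eval := by
  unfold SOE.eval
  fun_prop

/-- The convolution with a sum of exponentials, beyond the splitting point. -/
theorem SOE.integral_eval_mul (E : SOE) {φ : ℝ → ℂ} {T t₀ t : ℝ}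
    (hφ : ContinuousOn φ (Icc 0 T)) (ht₀ : 0 ≤ t₀) (ht : t₀ ≤ t) (htT : t ≤ T) :
    ∫ τ in t₀..t, E.eval τ * φ (t - τ) = ∑ l, E.M t₀ l * exactY (E.s l) φ (t - t₀) := by
  have h := intervalIntegral.integral_comp_sub_left (fun y => E.eval (t - y) * φ y) t
    (a := t₀) (b := t)
  simp only [sub_sub_cancel, sub_self] at h
  rw [h]
  have hi : ∀ l ∈ (Finset.univ : Finset (Fin E.P)), IntervalIntegrable (fun y : ℝ => E.M t₀ l *
      (Complex.exp (-E.s l * ((t - t₀ : ℝ) - y)) * φ y)) volume 0 (t - t₀) := fun l _ =>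
    (intervalIntegrable_exp_mul hφ (E.s l) (t - t₀) le_rfl (by linarith) (by linarith)).const_mul _
  simp only [exactY]
  simp_rw [← intervalIntegral.integral_const_mul]
  rw [← intervalIntegral.integral_finsetSum hi]
  refine intervalIntegral.integral_congr fun y _ => ?_
  rw [SOE.eval, Finset.sum_mul]
  refine Finset.sum_congr rfl fun l _ => ?_
  rw [SOE.M, mul_assoc, mul_assoc, ← mul_assoc (Complex.exp _) (Complex.exp _), ← Complex.exp_add]
  congr 3
  push_cast
  ring

/-- A left Riemann sum compared with the integral of the exponential, via `1 + r h ≤ exp (r h)`. The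
gain `1 / r` makes the Runge–Kutta feedback small in the weighted norm. -/
theorem mul_sum_exp_le {r h : ℝ} (hr : 0 < r) (n : ℕ) :
    h * ∑ j ∈ Finset.range n, Real.exp (r * (j * h)) ≤ Real.exp (r * (n * h)) / r := by
  induction n with
  | zero => simpa using hr.le
  | succ n ih =>
    rw [Finset.sum_range_succ, mul_add]
    have h1 : Real.exp (r * ((n + 1 : ℕ) * h)) = Real.exp (r * (n * h)) * Real.exp (r * h) := by
      rw [← Real.exp_add]; congr 1; push_cast; ring
    have h2 : r * h + 1 ≤ Real.exp (r * h) := Real.add_one_le_exp _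
    have h3 := mul_le_mul_of_nonneg_left h2 (Real.exp_pos (r * (n * h))).le
    rw [h1, le_div_iff₀ hr]
    rw [le_div_iff₀ hr] at ih
    nlinarith

/-- A Gronwall argument in a weighted maximum norm. -/
theorem le_of_weighted_contraction {n : ℕ} {e : ℕ → ℝ} {r ρ : ℝ} (hr : 0 ≤ r)
    (he : ∀ k, 0 ≤ e k)
    (H : ∀ X, 0 ≤ X → (∀ k ≤ n, e k ≤ X * Real.exp (r * k)) →
      ∀ k ≤ n, e k ≤ ρ + X / 2 * Real.exp (r * k)) (hρ : 0 ≤ ρ) :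
    ∀ k ≤ n, e k ≤ 2 * ρ * Real.exp (r * k) := by
  obtain ⟨k₀, hk₀, hmax⟩ := Finset.exists_max_image (Finset.range (n + 1))
    (fun k : ℕ => e k * Real.exp (-(r * k))) ⟨0, by simp⟩
  set X := e k₀ * Real.exp (-(r * k₀)) with hX
  have hX0 : 0 ≤ X := mul_nonneg (he _) (Real.exp_pos _).le
  have hle : ∀ k ≤ n, e k ≤ X * Real.exp (r * k) := by
    intro k hk
    have h1 := mul_le_mul_of_nonneg_right (hmax k (Finset.mem_range.2 (by omega)))
      (Real.exp_pos (r * k)).le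
    rwa [mul_assoc, ← Real.exp_add, neg_add_cancel, Real.exp_zero, mul_one] at h1
  have hk₀n : k₀ ≤ n := by have := Finset.mem_range.1 hk₀; omega
  have h1 := H X hX0 hle k₀ hk₀n
  -- The hypothesis is applied at the index where the weighted error attains its maximum `X`.
  have h2 : X ≤ ρ + X / 2 := by
    have h3 := mul_le_mul_of_nonneg_right h1 (Real.exp_pos (-(r * k₀))).le
    rw [add_mul, mul_assoc, ← Real.exp_add, add_neg_cancel, Real.exp_zero, mul_one] at h3
    have h4 : Real.exp (-(r * k₀)) ≤ 1 := Real.exp_le_one_iff.2 (by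
      have : 0 ≤ r * k₀ := by positivity
      linarith)
    have h5 := mul_le_of_le_one_right hρ h4
    linarith
  intro k hk
  refine (hle k hk).trans ?_
  gcongr
  linarith

/-- The scheme before and after the splitting point, in one formula. -/
theorem IsNumericalSolution.eq_split {S m : ℕ} {R : ButcherTableau S} {w : ℕ → Fin S → Fin m → ℝ}
    {E : SOE} {a : ℝ → ℂ} {g : ℝ → ℂ → ℂ} {fM : ℝ → ℂ} {L : ℕ} {ν : ℕ → ℕ → ℕ} {h : ℝ}
    {n₀ Nmax : ℕ} {U : ℕ → ℂ} (H : IsNumericalSolution R w E a g fM L ν h n₀ Nmax U)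
    {N : ℕ} (hN : N ≤ Nmax) :
    U N = a (N * h)
      + ∑ l, E.M (n₀ * h) l * rkY R w (E.s l) h (fun k => g (k * h) (U k)) (N - n₀)
      + ∫ τ in (0 : ℝ)..((min N n₀ : ℕ) * h),
          fM τ * localInterp L (ν N) h (fun k => g (k * h) (U k)) (N * h - τ) := by
  rcases Nat.lt_or_ge n₀ N with h1 | h1
  · rw [min_eq_right h1.le]
    exact H.step N hN h1
  -- Truncated subtraction gives step number 0, where every `rkY` vanishes and the sum drops out.
  · rw [min_eq_left h1, Nat.sub_eq_zero_of_le h1]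
    simpa [rkY] using H.start N hN h1

/-- The part of the solution beyond the splitting point, with the kernel replaced by a sum of
exponentials. -/
theorem norm_tail_sub_le {T Φ Q μ ε h : ℝ} {f φ : ℝ → ℂ} {E : SOE} {n₀ N : ℕ}
    {Y : Fin E.P → ℂ} (hf : IntervalIntegrable f volume 0 T) (hφ : ContinuousOn φ (Icc 0 T))
    (hΦ : ∀ x ∈ Icc 0 T, ‖φ x‖ ≤ Φ) (hε : 0 ≤ ε) (hh : 0 < h) (hN : (N : ℝ) * h ≤ T)
    (hE : ∀ x ∈ Icc (n₀ * h : ℝ) T, ‖f x - E.eval x‖ ≤ ε)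
    (hμ : ∑ l, ‖E.M (n₀ * h) l‖ ≤ μ) (hQ : 0 ≤ Q)
    (hY : ∀ l, ‖exactY (E.s l) φ ((N - n₀ : ℕ) * h) - Y l‖ ≤ Q) (hY0 : N ≤ n₀ → Y = 0) :
    ‖(∫ τ in ((min N n₀ : ℕ) * h : ℝ)..(N * h), f τ * φ (N * h - τ))
      - ∑ l, E.M (n₀ * h) l * Y l‖ ≤ T * Φ * ε + μ * Q := by
  have hT0 : 0 ≤ T := le_trans (by positivity) hN
  have hΦ0 : 0 ≤ Φ := (norm_nonneg _).trans (hΦ 0 ⟨le_rfl, hT0⟩)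
  have hμ0 : 0 ≤ μ := le_trans (by positivity) hμ
  rcases Nat.le_total N n₀ with h1 | h1
  · rw [min_eq_left h1, hY0 h1]
    simp only [intervalIntegral.integral_same, Pi.zero_apply, mul_zero, Finset.sum_const_zero,
      sub_zero, norm_zero]
    positivity
  rw [min_eq_right h1]
  have ht : (n₀ : ℝ) * h ≤ N * h := by gcongr
  have ht0 : (0 : ℝ) ≤ n₀ * h := by positivity
  have hφs : ContinuousOn (fun τ => φ (N * h - τ)) (uIcc (n₀ * h) (N * h)) := by
    refine hφ.comp (by fun_prop) fun τ hτ => ?_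
    rw [uIcc_of_le ht] at hτ
    exact ⟨by linarith [hτ.2], by linarith [hτ.1]⟩
  have hf' : IntervalIntegrable f volume (n₀ * h) (N * h) := hf.mono_set (by
    rw [uIcc_of_le ht, uIcc_of_le hT0]
    exact Icc_subset_Icc ht0 hN)
  have hsub := intervalIntegral.integral_sub (hf'.mul_continuousOn hφs)
    ((E.continuous_eval.intervalIntegrable _ _).mul_continuousOn hφs)
  rw [E.integral_eval_mul hφ ht0 ht hN] at hsub
  have hb1 : ‖∫ τ in (n₀ * h : ℝ)..(N * h), (f τ * φ (N * h - τ) - E.eval τ * φ (N * h - τ))‖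
      ≤ T * Φ * ε := by
    refine (intervalIntegral.norm_integral_le_of_norm_le_const (C := ε * Φ) fun τ hτ => ?_).trans ?_
    · rw [uIoc_of_le ht] at hτ
      rw [← sub_mul, norm_mul]
      exact mul_le_mul (hE τ ⟨hτ.1.le, hτ.2.trans hN⟩)
        (hΦ _ ⟨by linarith [hτ.2], by linarith [hτ.1]⟩) (norm_nonneg _) hε
    · rw [abs_of_nonneg (by linarith)]
      calc ε * Φ * (N * h - n₀ * h) ≤ ε * Φ * T := by gcongr; linarith
        _ = _ := by ring
  have hcast : ((N - n₀ : ℕ) : ℝ) * h = N * h - n₀ * h := by rw [Nat.cast_sub h1]; ring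
  have hb2 : ‖∑ l, E.M (n₀ * h) l * (exactY (E.s l) φ (N * h - n₀ * h) - Y l)‖ ≤ μ * Q := by
    refine (norm_sum_le_of_le _ (n := fun l => ‖E.M (n₀ * h) l‖ * Q) fun l _ => ?_).trans ?_
    · rw [norm_mul, ← hcast]
      exact mul_le_mul_of_nonneg_left (hY l) (norm_nonneg _)
    · rw [← Finset.sum_mul]
      exact mul_le_mul_of_nonneg_right hμ hQ
  have e : (∫ τ in (n₀ * h : ℝ)..(N * h), f τ * φ (N * h - τ)) - ∑ l, E.M (n₀ * h) l * Y l
      = (∫ τ in (n₀ * h : ℝ)..(N * h), (f τ * φ (N * h - τ) - E.eval τ * φ (N * h - τ)))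
        + ∑ l, E.M (n₀ * h) l * (exactY (E.s l) φ (N * h - n₀ * h) - Y l) := by
    rw [hsub]
    simp only [mul_sub, Finset.sum_sub_distrib]
    ring
  rw [e]
  exact (norm_add_le _ _).trans (add_le_add hb1 hb2)

/-! ### The overall error. -/

set_option maxHeartbeats 1600000 in
/-- The overall error of the scheme. -/
theorem exists_scheme_error_bound {S m : ℕ} {R : ButcherTableau S} {p : ℕ} (hp : R.HasOrder p)
    (hspec : R.HasPositiveSpectrum) (hstab : R.IsLStable) (hc : ∀ i, 0 ≤ R.c i ∧ R.c i ≤ 1)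
    (hm : 1 ≤ m) {L : ℕ} (hL : 1 ≤ L) {w : ℕ → Fin S → Fin m → ℝ}
    (hw : IsInterpolationOfOrder R w L) {T : ℝ} (hT : 0 < T) {f a u : ℝ → ℂ} {g : ℝ → ℂ → ℂ}
    (hf : IntervalIntegrable f volume 0 T)
    (hu : ∀ t ∈ Icc 0 T, u t = a t + ∫ τ in (0 : ℝ)..t, f (t - τ) * g τ (u τ))
    (hφp : ContDiffOn ℝ p (fun τ => g τ (u τ)) (Icc 0 T))
    (hφL : ContDiffOn ℝ L (fun τ => g τ (u τ)) (Icc 0 T))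
    {η K : ℝ} (hη : 0 < η) (huη : ∀ t ∈ Icc 0 T, ‖u t‖ ≤ η)
    (hLip : ∀ τ ∈ Icc 0 T, ∀ v₁ v₂ : ℂ, ‖v₁‖ ≤ η → ‖v₂‖ ≤ η →
      ‖g τ v₁ - g τ v₂‖ ≤ |K| * ‖v₁ - v₂‖)
    {fM : ℝ → ℂ} {M : ℕ} (hfM : IntervalIntegrable fM volume 0 T)
    (hO : (fun τ => f τ - fM τ) =O[𝓝[>] 0] (fun τ : ℝ => τ ^ (M + 1))) (σ μ B : ℝ) :
    ∃ C : ℝ, ∀ (E : SOE) (ε h : ℝ) (n₀ Nmax : ℕ) (ν : ℕ → ℕ → ℕ) (U : ℕ → ℂ),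
      0 < ε → 0 < h → (Nmax * h : ℝ) ≤ T → m ≤ Nmax + 1 → L ≤ Nmax + 1 →
      E.IsBoundedBy (n₀ * h) σ μ → (∀ l, ‖E.s l * h‖ ≤ 1) →
      (∀ x ∈ Icc (n₀ * h : ℝ) T, ‖f x - E.eval x‖ ≤ ε) →
      (n₀ * h : ℝ) ^ (M + 1) ≤ B * (h ^ (M + 1) + ε) →
      IsAdmissible L ν →
      IsNumericalSolution R w E a g fM L ν h n₀ Nmax U →
      (∀ j ≤ Nmax, ‖U j‖ ≤ η) →
      ∀ N ≤ Nmax, ‖u (N * h) - U N‖ ≤ C * (h ^ (min (M + 1) (min L p)) + ε) := by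
  set φ : ℝ → ℂ := fun τ => g τ (u τ) with hφdef
  have hφc : ContinuousOn φ (Icc 0 T) := hφL.continuousOn
  obtain ⟨Φ, hΦ⟩ := isCompact_Icc.exists_bound_of_continuousOn hφc
  have hΦ0 : 0 ≤ Φ := (norm_nonneg _).trans (hΦ 0 ⟨le_rfl, hT.le⟩)
  obtain ⟨CR, hCR0, hCR⟩ := exists_rkY_bound hp hspec hstab hc hm hw hT hφp hφL σ
  obtain ⟨CI, hCI0, hCI⟩ := exists_localInterp_bound hL hT hφL
  obtain ⟨CK, hCK0, hCK⟩ := exists_kernel_error_bound hT (hf.sub hfM) hO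
  set I := ∫ τ in (0 : ℝ)..T, ‖fM τ‖ with hI
  have hI0 : 0 ≤ I := intervalIntegral.integral_nonneg hT.le fun _ _ => norm_nonneg _
  -- The rate `r` makes the total feedback at most 1/4. Stencils looking ahead by at most `q = m +
  -- L` steps cost a further factor `exp (r q h) ≤ 2`, ensured by `h < h₀`, which leaves the
  -- contraction factor 1/2.
  obtain ⟨r, hr1, hr⟩ : ∃ r : ℝ, 1 ≤ r ∧
      CI * |K| * (∫ τ in (0 : ℝ)..T, ‖fM τ‖ * Real.exp (-(r * τ))) + |μ| * CR * |K| / r ≤ 1 / 4 := by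
    have h1 := (tendsto_integral_mul_exp_neg hT.le hfM.norm).const_mul (CI * |K|)
    have h2 : Tendsto (fun r : ℝ => |μ| * CR * |K| / r) atTop (𝓝 0) :=
      tendsto_const_nhds.div_atTop tendsto_id
    have h3 := h1.add h2
    rw [mul_zero, add_zero] at h3
    obtain ⟨r, hr, hr'⟩ := ((eventually_ge_atTop 1).and
      (h3.eventually (eventually_le_nhds (show (0 : ℝ) < 1 / 4 by norm_num)))).exists
    exact ⟨r, hr, hr'⟩
  have hr0 : 0 < r := by linarith
  set J := ∫ τ in (0 : ℝ)..T, ‖fM τ‖ * Real.exp (-(r * τ)) with hJ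
  set d := min (M + 1) (min L p) with hd
  set q : ℝ := m + L with hq
  have hq0 : 0 < q := by
    have : (1 : ℝ) ≤ m := by exact_mod_cast hm
    positivity
  set h₀ := min 1 (Real.log 2 / (r * q)) with hh₀
  have hh₀0 : 0 < h₀ := lt_min one_pos (div_pos (Real.log_pos (by norm_num)) (by positivity))
  set C₁ := CK * |B| * Φ + CI * I + T * Φ + |μ| * (CR * (2 * T)) with hC₁
  have hC₁0 : 0 ≤ C₁ := by positivity
  -- The second summand covers `h ≥ h₀`, where the trivial bound `2η` suffices.
  refine ⟨2 * C₁ * Real.exp (r * T) + 2 * η / h₀ ^ d,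
    fun E ε h n₀ Nmax ν U hε hh hNT hmN hLN hE hEh hEε hB hν hU hUη N hN => ?_⟩
  have hmem : ∀ k ≤ Nmax, (k : ℝ) * h ∈ Icc 0 T := fun k hk =>
    ⟨by positivity, le_trans (by gcongr) hNT⟩
  have hexp0 : 0 ≤ 2 * C₁ * Real.exp (r * T) := by positivity
  have hη0 : 0 ≤ 2 * η / h₀ ^ d := by positivity
  have hhd : 0 ≤ h ^ d := pow_nonneg hh.le _
  rcases le_or_gt h₀ h with hbig | hsmall
  · have h1 : ‖u (N * h) - U N‖ ≤ 2 * η :=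
      (norm_sub_le _ _).trans (by linarith [huη _ (hmem N hN), hUη N hN])
    have h2 : 2 * η ≤ 2 * η / h₀ ^ d * h ^ d := by
      rw [div_mul_eq_mul_div, le_div_iff₀ (by positivity)]
      gcongr
    refine (h1.trans h2).trans ?_
    refine mul_le_mul (by linarith) (by linarith) hhd (by positivity)
  have hh1 : h ≤ 1 := hsmall.le.trans (min_le_left _ _)
  have hexp : Real.exp (r * (q * h)) ≤ 2 := by
    rw [← Real.le_log_iff_exp_le (by norm_num)]
    have h1 : h ≤ Real.log 2 / (r * q) := hsmall.le.trans (min_le_right _ _)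
    rw [le_div_iff₀ (by positivity)] at h1
    linarith
  set ρ := C₁ * (h ^ d + ε) with hρ
  have hρ0 : 0 ≤ ρ := by positivity
  have hpowM : h ^ (M + 1) ≤ h ^ d := pow_le_pow_of_le_one hh.le hh1 (min_le_left _ _)
  have hpowL : h ^ L ≤ h ^ d :=
    pow_le_pow_of_le_one hh.le hh1 ((min_le_right _ _).trans (min_le_left _ _))
  have hpowp : h ^ p ≤ h ^ d :=
    pow_le_pow_of_le_one hh.le hh1 ((min_le_right _ _).trans (min_le_right _ _))
  have key : ∀ X : ℝ, 0 ≤ X → (∀ k ≤ Nmax, ‖u (k * h) - U k‖ ≤ X * Real.exp (r * h * k)) →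
      ∀ k ≤ Nmax, ‖u (k * h) - U k‖ ≤ ρ + X / 2 * Real.exp (r * h * k) := by
    clear N hN
    intro X hX0 hX N hN
    have hG : ∀ k ≤ Nmax, ‖φ (k * h) - g (k * h) (U k)‖ ≤ |K| * (X * Real.exp (r * h * k)) :=
      fun k hk => (hLip _ (hmem k hk) _ _ (huη _ (hmem k hk)) (hUη k hk)).trans
        (mul_le_mul_of_nonneg_left (hX k hk) (abs_nonneg _))
    set θ := min N n₀ with hθ
    have hθN : (θ : ℝ) * h ≤ N * h := by gcongr; exact min_le_left _ _
    have hθ0 : (0 : ℝ) ≤ θ * h := by positivity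
    have hNm := hmem N hN
    set W := Real.exp (r * h * N) with hW
    have hW0 : 0 < W := Real.exp_pos _
    have hfθ : IntervalIntegrable f volume 0 (θ * h) := hf.mono_set (by
      rw [uIcc_of_le hθ0, uIcc_of_le hT.le]
      exact Icc_subset_Icc le_rfl (hθN.trans hNm.2))
    have hfMθ : IntervalIntegrable fM volume 0 (θ * h) := hfM.mono_set (by
      rw [uIcc_of_le hθ0, uIcc_of_le hT.le]
      exact Icc_subset_Icc le_rfl (hθN.trans hNm.2))
    have hφN : ContinuousOn (fun τ => φ (N * h - τ)) (Icc 0 (N * h)) :=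
      hφc.comp (by fun_prop) fun τ hτ => ⟨by linarith [hτ.2], by linarith [hτ.1, hNm.2]⟩
    have hloc := norm_integral_mul_sub_integral_mul_le (t := θ * h) (Φ := Φ) hθ0
      (f := f) (F := fM) (ψ := fun τ => φ (N * h - τ))
      (π := fun τ => localInterp L (ν N) h (fun k => g (k * h) (U k)) (N * h - τ))
      (b := fun τ => CI * (h ^ L + |K| * (X * (2 * W * Real.exp (-(r * τ)))))) hfθ hfMθ
      (hφN.mono (Icc_subset_Icc le_rfl hθN))
      ((measurable_localInterp L (ν N) h _).comp (measurable_const.sub measurable_id))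
      (by fun_prop)
      (fun τ hτ => hΦ _ ⟨by linarith [hτ.2], by linarith [hτ.1, hNm.2]⟩) (by
        intro τ hτ
        set x := N * h - τ with hx
        have hx0 : 0 ≤ x := by linarith [hτ.2]
        have hxN : x < N * h := by linarith [hτ.1]
        -- Excluding `τ = 0` puts `x` strictly to the left of `Nh`, in a cell to which
        -- `IsAdmissible` applies.
        have hj : ⌊x / h⌋₊ < N := by
          rw [Nat.floor_lt (div_nonneg hx0 hh.le), div_lt_iff₀ hh]
          exact hxN
        obtain ⟨hν1, hν2, hν3⟩ := hν N _ hj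
        -- Starting stencils may use indices above `N`, but never above `max N (L - 1) ≤ Nmax`.
        have hidx : ∀ k < L, ν N ⌊x / h⌋₊ + k ≤ Nmax := fun k hk => by omega
        refine hCI h _ x (ν N) _ hh ⟨hx0, by linarith [hNm.2]⟩ hν1 hν2
          (fun k hk => (hmem _ (hidx k hk)).2) fun k hk => (hG _ (hidx k hk)).trans ?_
        have hjx : (⌊x / h⌋₊ : ℝ) * h ≤ x := by
          rw [← le_div_iff₀ hh]
          exact Nat.floor_le (div_nonneg hx0 hh.le)
        have h1 : ((ν N ⌊x / h⌋₊ + k : ℕ) : ℝ) * h ≤ x + q * h := by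
          have h2 : ((ν N ⌊x / h⌋₊ + k : ℕ) : ℝ) ≤ ⌊x / h⌋₊ + q := by
            have : ν N ⌊x / h⌋₊ + k ≤ ⌊x / h⌋₊ + (m + L) := by omega
            rw [hq]
            exact_mod_cast this
          have h3 := mul_le_mul_of_nonneg_right h2 hh.le
          rw [add_mul] at h3
          linarith
        have h3 : Real.exp (r * h * ((ν N ⌊x / h⌋₊ + k : ℕ) : ℝ))
            ≤ 2 * W * Real.exp (-(r * τ)) := by
          calc _ ≤ Real.exp (r * (q * h) + r * h * N + -(r * τ)) := by
                refine Real.exp_le_exp.2 ?_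
                have := mul_le_mul_of_nonneg_left h1 hr0.le
                rw [hx] at this
                linarith
            _ = Real.exp (r * (q * h)) * W * Real.exp (-(r * τ)) := by
                rw [Real.exp_add, Real.exp_add]
            _ ≤ _ := by gcongr
        gcongr)
    have hker : ∫ τ in (0 : ℝ)..(θ * h), ‖f τ - fM τ‖ ≤ CK * (|B| * (h ^ (M + 1) + ε)) := by
      refine hCK _ ⟨hθ0, hθN.trans hNm.2⟩ _ ?_
      have h1 : (θ : ℝ) * h ≤ n₀ * h := by gcongr; exact min_le_right _ _
      refine ((pow_le_pow_left₀ hθ0 h1 _).trans hB).trans ?_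
      gcongr
      exact le_abs_self B
    have hmain : ∫ τ in (0 : ℝ)..(θ * h),
        ‖fM τ‖ * (CI * (h ^ L + |K| * (X * (2 * W * Real.exp (-(r * τ))))))
          ≤ CI * I * h ^ L + 2 * (CI * |K| * J) * X * W := by
      have hi : IntervalIntegrable (fun τ => ‖fM τ‖ *
          (CI * (h ^ L + |K| * (X * (2 * W * Real.exp (-(r * τ))))))) volume 0 T :=
        hfM.norm.mul_continuousOn (Continuous.continuousOn (by fun_prop))
      have hi2 : IntervalIntegrable (fun τ => ‖fM τ‖ * Real.exp (-(r * τ))) volume 0 T :=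
        hfM.norm.mul_continuousOn (Continuous.continuousOn (by fun_prop))
      -- The integrand is nonnegative, so the integral may be extended to `[0, T]`; this makes the
      -- bound independent of `N` and `n₀` apart from the factor `W`.
      refine (intervalIntegral.integral_mono_interval le_rfl hθ0 (hθN.trans hNm.2)
        (Eventually.of_forall fun τ => by simp only [Pi.zero_apply]; positivity) hi).trans
        (le_of_eq ?_)
      rw [hI, hJ, ← intervalIntegral.integral_const_mul, ← intervalIntegral.integral_const_mul,
        ← intervalIntegral.integral_const_mul, ← intervalIntegral.integral_mul_const,
        ← intervalIntegral.integral_mul_const, ← intervalIntegral.integral_mul_const,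
        ← intervalIntegral.integral_add]
      · exact intervalIntegral.integral_congr fun τ _ => by ring
      · exact (hfM.norm.const_mul _).mul_const _
      · exact (((hi2.const_mul _).const_mul _).mul_const _).mul_const _
    have hnN : ((N - n₀ : ℕ) : ℝ) * h ≤ N * h := by gcongr; exact Nat.sub_le _ _
    have htop : ∀ j < N - n₀, topNode m j ≤ Nmax := fun j hj => max_le (by omega) (by omega)
    have hrk : ∀ l, ‖exactY (E.s l) φ ((N - n₀ : ℕ) * h)
        - rkY R w (E.s l) h (fun k => g (k * h) (U k)) (N - n₀)‖
          ≤ CR * (T * (h ^ p + h ^ L) + |K| * X * (2 * W / r)) := by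
      intro l
      refine (hCR (E.s l) h (fun k => g (k * h) (U k))
        -- The data used in step `j` have index at most `j + q`, so their weighted bounds grow
        -- geometrically in `j` and sum to `O(1/r)`.
        (fun j => |K| * X * (Real.exp (r * (q * h)) * Real.exp (r * (j * h)))) (E.re_nonneg l)
        (hE.1 l) hh.le (hEh l) (N - n₀) (fun j hj => (hmem _ (htop j hj)).2)
        (fun j hj k hk => (hG k (hk.trans (htop j hj))).trans ?_)).trans ?_
      · rw [← mul_assoc |K| X, ← Real.exp_add]
        have hkj : (k : ℝ) ≤ j + q := by
          have : k ≤ j + (m + L) := by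
            have : topNode m j ≤ j + m := max_le (by omega) (by omega)
            omega
          rw [hq]
          exact_mod_cast this
        have := mul_le_mul_of_nonneg_left hkj (mul_nonneg hr0.le hh.le)
        exact mul_le_mul_of_nonneg_left (Real.exp_le_exp.2 (by linarith)) (by positivity)
      · refine mul_le_mul_of_nonneg_left (add_le_add ?_ ?_) hCR0
        · exact mul_le_mul_of_nonneg_right (hnN.trans hNm.2) (by positivity)
        · rw [← Finset.mul_sum, ← Finset.mul_sum, mul_left_comm, mul_left_comm h]
          refine mul_le_mul_of_nonneg_left ?_ (by positivity)
          rw [mul_div_assoc]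
          refine mul_le_mul hexp ((mul_sum_exp_le hr0 _).trans ?_) (by positivity) (by norm_num)
          have := mul_le_mul_of_nonneg_left hnN hr0.le
          exact div_le_div_of_nonneg_right (Real.exp_le_exp.2 (by linarith)) hr0.le
    have htail := norm_tail_sub_le (Y := fun l =>
      rkY R w (E.s l) h (fun k => g (k * h) (U k)) (N - n₀)) hf hφc hΦ hε.le hh hNm.2 hEε
      (hE.2.trans (le_abs_self μ)) (by positivity) hrk (fun hle => by
        funext l
        simp [Nat.sub_eq_zero_of_le hle, rkY])
    have hconv : u (N * h) = a (N * h) + ((∫ τ in (0 : ℝ)..(θ * h), f τ * φ (N * h - τ))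
        + ∫ τ in (θ * h : ℝ)..(N * h), f τ * φ (N * h - τ)) := by
      rw [hu _ hNm]
      congr 1
      have h1 := intervalIntegral.integral_comp_sub_left (fun y => f y * φ (N * h - y)) (N * h : ℝ)
        (a := 0) (b := N * h)
      simp only [sub_sub_cancel, sub_self, sub_zero] at h1
      have hfN : IntervalIntegrable f volume 0 (N * h) := hf.mono_set (by
        rw [uIcc_of_le hNm.1, uIcc_of_le hT.le]
        exact Icc_subset_Icc le_rfl hNm.2)
      have h2 : IntervalIntegrable (fun τ => f τ * φ (N * h - τ)) volume 0 (N * h) :=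
        hfN.mul_continuousOn (by rwa [uIcc_of_le hNm.1])
      rw [intervalIntegral.integral_add_adjacent_intervals (h2.mono_set ?_) (h2.mono_set ?_)]
      · exact h1
      · rw [uIcc_of_le hθ0, uIcc_of_le hNm.1]
        exact Icc_subset_Icc le_rfl hθN
      · rw [uIcc_of_le hθN, uIcc_of_le hNm.1]
        exact Icc_subset_Icc hθ0 le_rfl
    have e := hU.eq_split hN
    rw [← hθ] at e
    rw [hconv, e]
    set A₁ := ∫ τ in (0 : ℝ)..(θ * h), f τ * φ (N * h - τ)
    set A₂ := ∫ τ in (θ * h : ℝ)..(N * h), f τ * φ (N * h - τ)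
    set A₃ := ∑ l, E.M (n₀ * h) l * rkY R w (E.s l) h (fun k => g (k * h) (U k)) (N - n₀)
    set A₄ := ∫ τ in (0 : ℝ)..(θ * h),
          fM τ * localInterp L (ν N) h (fun k => g (k * h) (U k)) (N * h - τ)
    rw [show a (N * h) + (A₁ + A₂) - (a (N * h) + A₃ + A₄) = (A₁ - A₄) + (A₂ - A₃) by ring]
    refine ((norm_add_le _ _).trans (add_le_add (hloc.trans (add_le_add
      (mul_le_mul_of_nonneg_right hker hΦ0) hmain)) htail)).trans ?_
    have hXW : 0 ≤ X * W := by positivity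
    have h1 := mul_le_mul_of_nonneg_right hr hXW
    have h2 : CK * (|B| * (h ^ (M + 1) + ε)) * Φ + CI * I * h ^ L + T * Φ * ε
        + |μ| * (CR * (T * (h ^ p + h ^ L))) ≤ ρ := by
      have b1 : CK * (|B| * (h ^ (M + 1) + ε)) * Φ ≤ CK * |B| * Φ * (h ^ d + ε) := by
        rw [show CK * (|B| * (h ^ (M + 1) + ε)) * Φ = CK * |B| * Φ * (h ^ (M + 1) + ε) by ring]
        gcongr
      have b2 : CI * I * h ^ L ≤ CI * I * (h ^ d + ε) := by
        gcongr; linarith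
      have b3 : T * Φ * ε ≤ T * Φ * (h ^ d + ε) := by
        gcongr; linarith
      have b4 : |μ| * (CR * (T * (h ^ p + h ^ L))) ≤ |μ| * (CR * (2 * T)) * (h ^ d + ε) := by
        rw [show |μ| * (CR * (2 * T)) * (h ^ d + ε) = |μ| * (CR * (T * (2 * (h ^ d + ε)))) by ring]
        gcongr; linarith
      rw [hρ, hC₁]
      linarith
    have h3 : |μ| * (CR * (T * (h ^ p + h ^ L) + |K| * X * (2 * W / r)))
        = |μ| * (CR * (T * (h ^ p + h ^ L))) + 2 * (|μ| * CR * |K| / r) * (X * W) := by ring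
    rw [h3]
    linarith
  have hfin := le_of_weighted_contraction (e := fun k : ℕ => ‖u (k * h) - U k‖)
    (mul_nonneg hr0.le hh.le) (fun _ => norm_nonneg _) key hρ0 N hN
  refine hfin.trans ?_
  have hexpT : Real.exp (r * h * N) ≤ Real.exp (r * T) := by
    refine Real.exp_le_exp.2 ?_
    have := mul_le_mul_of_nonneg_left (hmem N hN).2 hr0.le
    linarith
  calc 2 * ρ * Real.exp (r * h * N) ≤ 2 * ρ * Real.exp (r * T) := by gcongr
    _ = 2 * C₁ * Real.exp (r * T) * (h ^ d + ε) := by rw [hρ]; ring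
    _ ≤ _ := by gcongr; linarith

end SOEVolterra

end

theorem mainTheorem4
    -- the Runge-Kutta method
    {S : ℕ} (R : ButcherTableau S) (p q : ℕ) (hp : R.HasOrder p) (hq : R.HasStageOrder q)
    (hqp : q + 1 ≤ p) (hspec : R.HasPositiveSpectrum) (hstab : R.IsLStable)
    (hc : ∀ i, 0 ≤ R.c i ∧ R.c i ≤ 1)
    -- the interpolation of the internal stages
    (m L : ℕ) (hm : 1 ≤ m) (hL : 1 ≤ L) (w : ℕ → Fin S → Fin m → ℝ)
    (hw : IsInterpolationOfOrder R w L)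
    -- the Volterra equation on `[0, Tmax]` and its solution `u`
    (Tmax : ℝ) (hT : 0 < Tmax) (f a u : ℝ → ℂ) (g : ℝ → ℂ → ℂ)
    (hf : IntervalIntegrable f volume 0 Tmax)
    (hu : ∀ t ∈ Icc 0 Tmax, u t = a t + ∫ τ in (0 : ℝ)..t, f (t - τ) * g τ (u τ))
    -- `g` is continuous in time, and `g(τ, u(τ))` is smooth
    (hg : ∀ v, ContinuousOn (fun τ => g τ v) (Icc 0 Tmax))
    (γ : ℕ) (hγp : p ≤ γ) (hγL : L ≤ γ)
    (hgu : ContDiffOn ℝ γ (fun τ => g τ (u τ)) (Icc 0 Tmax))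
    -- local Lipschitz condition on the ball of radius `η`, which contains the solution
    (η Cη : ℝ) (hη : 0 < η) (huη : ∀ t ∈ Icc 0 Tmax, ‖u t‖ ≤ η)
    (hLip : ∀ τ, 0 < τ → τ < Tmax → ∀ v₁ v₂ : ℂ, ‖v₁‖ ≤ η → ‖v₂‖ ≤ η →
      ‖g τ v₁ - g τ v₂‖ ≤ Cη * ‖v₁ - v₂‖) :
    -- the bound of the Runge-Kutta error
    (∀ σ μ : ℝ, ∃ C₂ : ℝ, ∀ (E : SOE) (h : ℝ) (n₀ NT : ℕ) (U : ℕ → ℂ),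
      0 < h → (NT * h : ℝ) ≤ Tmax → m ≤ NT + 1 →
      E.IsBoundedBy (n₀ * h) σ μ → (∀ l, ‖E.s l * h‖ ≤ 1) →
      (∀ j ≤ NT, ‖U j‖ ≤ η) →
      ∀ l, ‖rkError R w E g u U (n₀ * h) h NT l‖ ≤
        C₂ * ((Finset.range (NT + 1)).sup' Finset.nonempty_range_add_one
          (fun j => ‖U j - u (j * h)‖) + h ^ p + h ^ L)) ∧
    -- the overall error
    (∀ (M : ℕ) (α : ℝ) (κ : ℕ → ℂ), 0 ≤ α → α < 1 →
      (fun τ => f τ - genTaylor α κ M τ) =O[𝓝[>] 0] (fun τ => τ ^ (M + 1)) →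
      ∀ σ μ B : ℝ, ∃ C : ℝ, ∀ (E : SOE) (ε h : ℝ) (n₀ Nmax : ℕ) (ν : ℕ → ℕ → ℕ) (U : ℕ → ℂ),
        0 < ε → 0 < h → (Nmax * h : ℝ) ≤ Tmax → m ≤ Nmax + 1 → L ≤ Nmax + 1 →
        E.IsBoundedBy (n₀ * h) σ μ → (∀ l, ‖E.s l * h‖ ≤ 1) →
        (∀ x ∈ Icc (n₀ * h : ℝ) Tmax, ‖f x - E.eval x‖ ≤ ε) →
        (n₀ * h : ℝ) ^ (M + 1) ≤ B * (h ^ (M + 1) + ε) →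
        IsAdmissible L ν →
        IsNumericalSolution R w E a g (genTaylor α κ M) L ν h n₀ Nmax U →
        (∀ j ≤ Nmax, ‖U j‖ ≤ η) →
        ∀ N ≤ Nmax, ‖u (N * h) - U N‖ ≤ C * (h ^ (min (M + 1) (min L p)) + ε)) := by
  have hLip' : ∀ τ ∈ Icc 0 Tmax, ∀ v₁ v₂ : ℂ, ‖v₁‖ ≤ η → ‖v₂‖ ≤ η →
      ‖g τ v₁ - g τ v₂‖ ≤ |Cη| * ‖v₁ - v₂‖ := fun τ hτ v₁ v₂ h₁ h₂ =>
    lipschitz_on_Icc hT hg hLip hτ h₁ h₂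
  have hφp : ContDiffOn ℝ p (fun τ => g τ (u τ)) (Icc 0 Tmax) := hgu.of_le (by exact_mod_cast hγp)
  have hφL : ContDiffOn ℝ L (fun τ => g τ (u τ)) (Icc 0 Tmax) := hgu.of_le (by exact_mod_cast hγL)
  refine ⟨exists_rkError_bound hp hspec hstab hc hm hw hT hφp hφL huη hLip',
    fun M α κ _ hα hO σ μ B => ?_⟩
  exact exists_scheme_error_bound hp hspec hstab hc hm hL hw hT hf hu hφp hφL hη huη hLip'
    (intervalIntegrable_genTaylor hα κ M 0 Tmax) hO σ μ B
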